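/- Let $b = 1+\sqrt2$, and let $\mu(H)$ denote the size of a maximum matching of a graph $H$. For a graph $H$, a \emph{random greedy maximal matching} of $H$ is obtained by going through the edges of $H$ in a uniformly random order and adding an edge whenever neither of its endpoints is already matched. For disjoint vertex sets $A,B$ of a graph $G$, let $G[A,B]$ be the graph of all edges of $G$ between $A$ and $B$. Its \emph{random greedy maximal $b$-matching} with capacities $k$ on $A$ and $\lceil kb\rceil$ on $B$ is the random multiset of edges of $G[A,B]$ obtained as follows: replace each vertex of $A$ by $k$ copies and each vertex of $B$ by $\lceil kb\rceil$ copies, join all copies of $u$ to all copies of $v$ whenever $uv$ is an edge of $G[A,B]$, take a random greedy maximal matching of the resulting graph, and replace each of its edges by the corresponding edge of $G[A,B]$. There is an absolute constant $\varepsilon_0>0$ such that for every $\varepsilon\in(0,\varepsilon_0)$ and every integer $k>\frac{1}{b\varepsilon^3}$ the following holds. Let $G=(V,E)$ be any finite simple graph (not necessarily bipartite), let $M$ be any matching in $G$, and let $V(M)$ be the set of vertices matched by $M$. Let $M'$ be a random greedy maximal matching of $G[V\setminus V(M)]$; given $M'$, let $B_1$ be a random greedy maximal $b$-matching of $G[V(M'),\,V\setminus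 V(M)\setminus V(M')]$ with capacities $k$ on $V(M')$ and $\lceil kb\rceil$ on $V\setminus V(M)\setminus V(M')$ (with fresh randomness); and let $B_2$ be a random greedy maximal $b$-matching of $G[V(M),\,V\setminus V(M)]$ with capacities $k$ on $V(M)$ and $\lceil kb\rceil$ on $V\setminus V(M)$. Then $$(1-\varepsilon)\,\max\Big(|M|+\mathbb E\big[\mu(M'\cup B_1)\big],\ \mathbb E\big[\mu(M\cup B_2)\big]\Big)\ \ge\ 0.5109\cdot\mu(G),$$ where $M'\cup B_1$ and $M\cup B_2$ are viewed as the subgraphs of $G$ formed by these edges. -/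

import Mathlib

open scoped BigOperators

namespace SublinearMatching

/-- The size `μ(G)` of a maximum matching of a finite graph `G`. -/
noncomputable def maxMatchingSize {V : Type*} [Fintype V] (G : SimpleGraph V) : ℕ :=
  sSup {m : ℕ | ∃ N : G.Subgraph, N.IsMatching ∧ N.edgeSet.ncard = m}

/-- The set of vertices covered by a set of edges. -/
def coveredVerts {V : Type*} (F : Finset (Sym2 V)) : Set V :=
  {v | ∃ e ∈ F, v ∈ e}

open Classical in
/-- One step of the greedy process: the edge `e` is added to `F` if and only if none of its
endpoints is already covered by `F`. -/
noncomputable def greedyStep {V : Type*} (F : Finset (Sym2 V)) (e : Sym2 V) :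
    Finset (Sym2 V) :=
  if ∃ v ∈ e, v ∈ coveredVerts F then F else insert e F

/-- The permutations of the edges of `H`, given as enumerations `0, 1, …, |E(H)| - 1` of `E(H)`. -/
abbrev EdgeOrder {V : Type*} (H : SimpleGraph V) : Type _ :=
  Fin (Nat.card H.edgeSet) ≃ H.edgeSet

/-- `GMM(H, π)`: the greedy maximal matching of `H` for the edge permutation `π`. -/
noncomputable def greedyMatching {V : Type*} (H : SimpleGraph V) (π : EdgeOrder H) :
    Finset (Sym2 V) :=
  (List.ofFn fun i => (π i : Sym2 V)).foldl greedyStep ∅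

open Classical in
/-- The expectation of `f N`, where `N` is the random greedy maximal matching of `H`, that is,
`N = GMM(H, π)` for a uniformly random permutation `π` of the edges of `H`. -/
noncomputable def expectRGMM {V : Type*} [Fintype V] (H : SimpleGraph V)
    (f : Finset (Sym2 V) → ℝ) : ℝ :=
  𝔼 π : EdgeOrder H, f (greedyMatching H π)

open Classical in
/-- Vertex capacities: `k` on `A`, `K` on `B`. (Vertices outside `A ∪ B` are not present in
`G[A, B]`, so they get no copies.) -/
noncomputable def capacity {V : Type*} (A B : Set V) (k K : ℕ) (v : V) : ℕ :=
  if v ∈ A then k else if v ∈ B then K else 0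

/-- The graph obtained from `H` by replacing every vertex `v` by `c v` copies, and every edge `uv`
by all edges between the copies of `u` and the copies of `v`. -/
def copiesGraph {V : Type*} (H : SimpleGraph V) (c : V → ℕ) :
    SimpleGraph (Σ v : V, Fin (c v)) :=
  H.comap Sigma.fst

/-- The multiset of edges of the original graph given by a set of edges between copies. -/
def projectEdges {V : Type*} {c : V → ℕ} (N : Finset (Sym2 (Σ v : V, Fin (c v)))) :
    Multiset (Sym2 V) :=
  N.val.map (Sym2.map Sigma.fst)

/-- The expectation of `f F`, where `F` is the random greedy maximal `b`-matching of `G[A, B]`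
with capacity `k` on the vertices of `A` and `K` on the vertices of `B`, that is, the
multiset of edges of `G[A, B]` given by a random greedy maximal matching between copies. -/
noncomputable def expectRGBMatching {V : Type*} [Fintype V] (G : SimpleGraph V) (A B : Set V)
    (k K : ℕ) (f : Multiset (Sym2 V) → ℝ) : ℝ :=
  expectRGMM (copiesGraph (G.between A B) (capacity A B k K)) fun N => f (projectEdges N)

/-- `E[μ(M' ∪ B₁)]`: here `M'` is the random greedy maximal matching of `G[V ∖ V(M)]` and, given
`M'`, `B₁` is the random greedy maximal `b`-matching of `G[V(M'), V ∖ V(M) ∖ V(M')]`. -/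
noncomputable def expectFirst {V : Type*} [Fintype V] (G : SimpleGraph V) (M : G.Subgraph)
    (k K : ℕ) : ℝ :=
  expectRGMM (G.induce M.vertsᶜ).spanningCoe fun M' =>
    expectRGBMatching G (coveredVerts M') (M.vertsᶜ \ coveredVerts M') k K fun B₁ =>
      (maxMatchingSize (SimpleGraph.fromEdgeSet {e | e ∈ M' ∨ e ∈ B₁}) : ℝ)

/-- `E[μ(M ∪ B₂)]`: here `B₂` is the random greedy maximal `b`-matching of
`G[V(M), V ∖ V(M)]`. -/
noncomputable def expectSecond {V : Type*} [Fintype V] (G : SimpleGraph V) (M : G.Subgraph)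
    (k K : ℕ) : ℝ :=
  expectRGBMatching G M.verts M.vertsᶜ k K fun B₂ =>
    (maxMatchingSize (SimpleGraph.fromEdgeSet {e | e ∈ M.edgeSet ∨ e ∈ B₂}) : ℝ)

end SublinearMatching

/-! Let `X` be a maximum matching, μ its size, m = |M|, and n the number of edges of `X` that avoid
V(M). The core is `le_expectRGBMatching`: a matching `F` on the vertex set `A`, together with the
random greedy b-matching between `A` and a disjoint set `W`, contains in expectation a matching of
size about (2 - √2)|F| + (1 - √2/2)|N| for every matching `N` between `A` and `W`. Counting the ends
of `X` in V(F) turns this into (2 - √2) times the number of edges of `X` that meet V(F). This is (2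
- √2)(μ - n) for M, and (2 - √2)n for M', since the maximal matching M' meets all n edges that M
avoids. As μ ≤ 2m + n, the first option is worth at least μ/2 + (3/2 - √2)n. It grows with n while
the second option shrinks; they cross near n = 0.1277μ, at about 0.51095μ (`tradeoff`).

The core bound has a random half and a deterministic half.

Random half: fix an edge zy of `N`. As long as z and y keep a θ-fraction of free copies, edges over
zy arrive at a rate comparable to that of any other edge at z. So an edge over zy is likely to
appear before the star at z concentrates on few neighbours. An exponential potential,
`starPotential`, is a supermartingale and makes this precise. Hence (`card_not_good_le`), up to
probability 2θ, either zy is present or one of its ends is almost saturated by edges of small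
multiplicity.

Deterministic half (`exists_augmentation`): capped multiplicities divided by the larger capacity
form a fractional matching with tiny entries, of load at most √2 - 1 on `A` and 1 on `W`. An edge of
`F` gains one when both its ends receive private partners in `W`. An end uses either its `N`-mate or
its light fractional edges. Vertices of `W` are reserved for mates with probability about 1 - load,
and the others serve light edges; variance bounds and Hall's theorem with deficiency show that
almost no active light end is left over. If the ends have loads a, b and their mates residual
capacities c, d, the best of the four ways to serve a pair succeeds with probability about (1 -
√2/2)(a + b + c + d - √2) or more (`exists_good_mode`). In the sum over all pairs the loads cancel
and |N| remains.

The accuracy θ = 10⁻⁶ is fixed; small ε only forces k to be large. -/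

namespace SublinearMatching

/-! ### Supermartingales along a uniformly random order -/

/-- The state of a process driven by the order `π` after `t` steps. -/
def prefixState {α σ : Type*} {n : ℕ} (step : σ → α → σ) (s₀ : σ) (π : Fin n → α) (t : ℕ) : σ :=
  ((List.ofFn π).take t).foldl step s₀

lemma prefixState_succ {α σ : Type*} {n : ℕ} (step : σ → α → σ) (s₀ : σ) (π : Fin n → α)
    (t : ℕ) (ht : t < n) :
    prefixState step s₀ π (t + 1) = step (prefixState step s₀ π t) (π ⟨t, ht⟩) := by
  unfold prefixState
  rw [List.take_succ_eq_append_getElem (by simpa using ht), List.foldl_append]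
  simp

lemma prefixState_congr {α σ : Type*} {n : ℕ} (step : σ → α → σ) (s₀ : σ) (π π' : Fin n → α)
    (t : ℕ) (ht : t ≤ n) (h : ∀ i : Fin n, i.1 < t → π i = π' i) :
    prefixState step s₀ π t = prefixState step s₀ π' t := by
  induction t with
  | zero => simp [prefixState]
  | succ t ih =>
    rw [prefixState_succ _ _ _ _ ht, prefixState_succ _ _ _ _ ht,
      ih (Nat.le_of_succ_le ht) (fun i hi => h i (Nat.lt_succ_of_lt hi)),
      h ⟨t, ht⟩ (Nat.lt_succ_self t)]

/-- An element is inert right after it is read, and inertness persists. So the drift may be summed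
over all elements instead of the unread ones only. -/
lemma step_prefixState {α σ : Type*} {n : ℕ} (step : σ → α → σ) (s₀ : σ) (π : Fin n → α)
    (h₀ : ∀ s e, step (step s e) e = step s e)
    (h₁ : ∀ s e e', step s e = s → step (step s e') e = step s e')
    (t : ℕ) (ht : t ≤ n) (i : Fin n) (hi : i.1 < t) :
    step (prefixState step s₀ π t) (π i) = prefixState step s₀ π t := by
  induction t with
  | zero => omega
  | succ t ih =>
    rw [prefixState_succ _ _ _ _ ht]
    rcases Nat.lt_succ_iff_lt_or_eq.mp hi with h | h
    · exact h₁ _ _ _ (ih (Nat.le_of_succ_le ht) h)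
    · have : i = ⟨t, ht⟩ := Fin.ext h
      rw [this]
      exact h₀ _ _

/-- A supermartingale bound for processes driven by a uniformly random order. -/
lemma sum_orders_le_of_supermartingale {α σ : Type*} [Fintype α] (n : ℕ)
    [Fintype (Fin n ≃ α)]
    (step : σ → α → σ) (s₀ : σ) (Φ : σ → ℝ)
    (h₀ : ∀ s e, step (step s e) e = step s e)
    (h₁ : ∀ s e e', step s e = s → step (step s e') e = step s e')
    (hΦ : ∀ s, ∑ e, (Φ (step s e) - Φ s) ≤ 0) :
    ∑ π : Fin n ≃ α, Φ ((List.ofFn π).foldl step s₀) ≤ ∑ _π : Fin n ≃ α, Φ s₀ := by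
  classical
  have key : ∀ t, t ≤ n → ∑ π : Fin n ≃ α, Φ (prefixState step s₀ π t) ≤
      ∑ _π : Fin n ≃ α, Φ s₀ := by
    intro t
    induction t with
    | zero => intro _; simp [prefixState]
    | succ t ih =>
      intro ht
      refine le_trans ?_ (ih (Nat.le_of_succ_le ht))
      set τ : Fin n := ⟨t, ht⟩
      -- Exchanging positions `t` and `j ≥ t` of the order does not affect its first `t` entries, so
      -- all unread positions have the same total increment.
      have hre : ∀ j : Fin n, t ≤ j.1 →
          ∑ π : Fin n ≃ α, (Φ (step (prefixState step s₀ π t) (π j)) -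
            Φ (prefixState step s₀ π t)) =
          ∑ π : Fin n ≃ α, (Φ (step (prefixState step s₀ π t) (π τ)) -
            Φ (prefixState step s₀ π t)) := by
        intro j hj
        refine Fintype.sum_equiv ((Equiv.swap τ j).equivCongr (Equiv.refl α)) _ _ ?_
        intro π
        have hs : prefixState step s₀ ⇑(((Equiv.swap τ j).equivCongr (Equiv.refl α)) π) t =
            prefixState step s₀ π t := by
          refine prefixState_congr _ _ _ _ _ (Nat.le_of_succ_le ht) ?_
          intro i hi
          have h1 : i ≠ τ := by rintro rfl; simp [τ] at hi
          have h2 : i ≠ j := by rintro rfl; omega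
          simp [Equiv.swap_apply_of_ne_of_ne h1 h2]
        rw [hs]
        simp
      have hzero : ∀ j : Fin n, j.1 < t →
          ∑ π : Fin n ≃ α, (Φ (step (prefixState step s₀ π t) (π j)) -
            Φ (prefixState step s₀ π t)) = 0 := by
        intro j hj
        refine Finset.sum_eq_zero fun π _ => ?_
        rw [step_prefixState step s₀ π h₀ h₁ t (Nat.le_of_succ_le ht) j hj, sub_self]
      set D := ∑ π : Fin n ≃ α, (Φ (step (prefixState step s₀ π t) (π τ)) -
            Φ (prefixState step s₀ π t)) with hD
      have htot : ∑ j : Fin n, ∑ π : Fin n ≃ α, (Φ (step (prefixState step s₀ π t) (π j)) -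
            Φ (prefixState step s₀ π t)) ≤ 0 := by
        rw [Finset.sum_comm]
        refine Finset.sum_nonpos fun π _ => ?_
        rw [Equiv.sum_comp π (fun e => Φ (step (prefixState step s₀ π t) e) -
            Φ (prefixState step s₀ π t))]
        exact hΦ _
      have hsplit : ∑ j : Fin n, ∑ π : Fin n ≃ α,
          (Φ (step (prefixState step s₀ π t) (π j)) - Φ (prefixState step s₀ π t)) =
          ∑ j : Fin n, if t ≤ j.1 then D else 0 := by
        refine Finset.sum_congr rfl fun j _ => ?_
        split_ifs with h
        · exact hre j h
        · exact hzero j (not_le.mp h)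
      -- The total drift is `D` times the positive number of unread positions, so it has the sign of
      -- `D`.
      have hDle : D ≤ 0 := by
        by_contra hpos
        push Not at hpos
        rw [hsplit] at htot
        have : D ≤ ∑ j : Fin n, if t ≤ j.1 then D else 0 := by
          have := Finset.single_le_sum (f := fun j : Fin n => if t ≤ j.1 then D else 0)
            (fun j _ => by split_ifs <;> linarith) (Finset.mem_univ τ)
          simpa [τ] using this
        linarith
      rw [hD, Finset.sum_sub_distrib] at hDle
      have : ∀ π : Fin n ≃ α, prefixState step s₀ π (t + 1) =
          step (prefixState step s₀ π t) (π τ) := fun π => prefixState_succ _ _ _ _ ht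
      simp only [this]
      linarith
  have := key n le_rfl
  refine le_trans (le_of_eq ?_) this
  refine Finset.sum_congr rfl fun π _ => ?_
  unfold prefixState
  rw [List.take_of_length_le (by simp)]

/-! ### The greedy process and its stopped version -/

/-- The edges in `F` are pairwise disjoint. -/
def EdgeMatching {V : Type*} (F : Finset (Sym2 V)) : Prop :=
  ∀ e ∈ F, ∀ e' ∈ F, ∀ v, v ∈ e → v ∈ e' → e = e'

lemma coveredVerts_mono {V : Type*} {F F' : Finset (Sym2 V)} (h : F ⊆ F') :
    coveredVerts F ⊆ coveredVerts F' := fun _ ⟨e, he, hv⟩ => ⟨e, h he, hv⟩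

lemma subset_greedyStep {V : Type*} (F : Finset (Sym2 V)) (e : Sym2 V) : F ⊆ greedyStep F e := by
  classical
  unfold greedyStep
  split_ifs
  · exact subset_rfl
  · intro x hx
    exact Finset.mem_insert_of_mem hx

lemma greedyStep_of_covered {V : Type*} {F : Finset (Sym2 V)} {e : Sym2 V}
    (h : ∃ v ∈ e, v ∈ coveredVerts F) : greedyStep F e = F := if_pos h

open Classical in
lemma greedyStep_of_free {V : Type*} {F : Finset (Sym2 V)} {e : Sym2 V}
    (h : ¬ ∃ v ∈ e, v ∈ coveredVerts F) : greedyStep F e = insert e F := if_neg h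

lemma exists_covered_greedyStep {V : Type*} (F : Finset (Sym2 V)) (e : Sym2 V) :
    ∃ v ∈ e, v ∈ coveredVerts (greedyStep F e) := by
  classical
  by_cases h : ∃ v ∈ e, v ∈ coveredVerts F
  · rwa [greedyStep_of_covered h]
  · rw [greedyStep_of_free h]
    induction e with
    | _ x y => exact ⟨x, by simp, s(x, y), by simp, by simp⟩

lemma notMem_of_free {V : Type*} {F : Finset (Sym2 V)} {e : Sym2 V}
    (h : ¬ ∃ v ∈ e, v ∈ coveredVerts F) : e ∉ F := by
  intro he
  apply h
  induction e with
  | _ x y => exact ⟨x, by simp, s(x, y), he, by simp⟩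

lemma greedyStep_eq_self_iff {V : Type*} (F : Finset (Sym2 V)) (e : Sym2 V) :
    greedyStep F e = F ↔ ∃ v ∈ e, v ∈ coveredVerts F := by
  constructor
  · intro h
    have := exists_covered_greedyStep F e
    rwa [h] at this
  · exact greedyStep_of_covered

lemma EdgeMatching.greedyStep {V : Type*} {F : Finset (Sym2 V)} (hF : EdgeMatching F)
    (e : Sym2 V) : EdgeMatching (greedyStep F e) := by
  classical
  by_cases h : ∃ v ∈ e, v ∈ coveredVerts F
  · rwa [greedyStep_of_covered h]
  · rw [greedyStep_of_free h]
    intro a ha b hb v hva hvb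
    rw [Finset.mem_insert] at ha hb
    rcases ha with rfl | ha <;> rcases hb with rfl | hb
    · rfl
    · exact absurd ⟨v, hva, b, hb, hvb⟩ h
    · exact absurd ⟨v, hvb, a, ha, hva⟩ h
    · exact hF a ha b hb v hva hvb

open Classical in
/-- The greedy process that is frozen as soon as its state satisfies `Stop`. -/
noncomputable def stoppedStep {V : Type*} (Stop : Finset (Sym2 V) → Prop)
    (F : Finset (Sym2 V)) (e : Sym2 V) : Finset (Sym2 V) :=
  if Stop F then F else greedyStep F e

lemma stoppedStep_idem {V : Type*} (Stop : Finset (Sym2 V) → Prop)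
    (F : Finset (Sym2 V)) (e : Sym2 V) :
    stoppedStep Stop (stoppedStep Stop F e) e = stoppedStep Stop F e := by
  by_cases h : Stop F
  · simp [stoppedStep, h]
  · have h1 : stoppedStep Stop F e = greedyStep F e := if_neg h
    rw [h1]
    unfold stoppedStep
    split_ifs
    · rfl
    · exact greedyStep_of_covered (exists_covered_greedyStep _ _)

/-- Freezing and covering are both irreversible. Together with `stoppedStep_idem` this supplies the
inertness hypotheses of `sum_orders_le_of_supermartingale`. -/
lemma stoppedStep_persist {V : Type*} (Stop : Finset (Sym2 V) → Prop)
    (F : Finset (Sym2 V)) (e e' : Sym2 V) (he : stoppedStep Stop F e = F) :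
    stoppedStep Stop (stoppedStep Stop F e') e = stoppedStep Stop F e' := by
  by_cases h : Stop F
  · simp [stoppedStep, h]
  · have h1 : ∀ a, stoppedStep Stop F a = greedyStep F a := fun a => if_neg h
    rw [h1] at he
    rw [h1]
    unfold stoppedStep
    split_ifs
    · rfl
    · obtain ⟨v, hv, hc⟩ := (greedyStep_eq_self_iff _ _).mp he
      exact greedyStep_of_covered ⟨v, hv, coveredVerts_mono (subset_greedyStep _ _) hc⟩

lemma foldl_greedyStep_subset {V : Type*} (L : List (Sym2 V)) (F : Finset (Sym2 V)) :
    F ⊆ L.foldl greedyStep F := by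
  induction L generalizing F with
  | nil => exact subset_rfl
  | cons e L ih => exact (subset_greedyStep F e).trans (ih _)

lemma foldl_stoppedStep_of_stop {V : Type*} (Stop : Finset (Sym2 V) → Prop) (L : List (Sym2 V))
    (F : Finset (Sym2 V)) (h : Stop F) : L.foldl (stoppedStep Stop) F = F := by
  induction L with
  | nil => rfl
  | cons e L ih => rw [List.foldl_cons, show stoppedStep Stop F e = F from if_pos h, ih]

lemma foldl_stoppedStep_subset {V : Type*} (Stop : Finset (Sym2 V) → Prop) (L : List (Sym2 V))
    (F : Finset (Sym2 V)) : L.foldl (stoppedStep Stop) F ⊆ L.foldl greedyStep F := by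
  induction L generalizing F with
  | nil => exact subset_rfl
  | cons e L ih =>
    by_cases h : Stop F
    · rw [foldl_stoppedStep_of_stop _ _ _ h]
      exact foldl_greedyStep_subset _ _
    · rw [List.foldl_cons, List.foldl_cons, show stoppedStep Stop F e = greedyStep F e from if_neg h]
      exact ih _

lemma stop_foldl_stoppedStep_or_eq {V : Type*} (Stop : Finset (Sym2 V) → Prop)
    (L : List (Sym2 V)) (F : Finset (Sym2 V)) :
    Stop (L.foldl (stoppedStep Stop) F) ∨
      L.foldl (stoppedStep Stop) F = L.foldl greedyStep F := by
  induction L generalizing F with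
  | nil => exact Or.inr rfl
  | cons e L ih =>
    by_cases h : Stop F
    · rw [foldl_stoppedStep_of_stop _ _ _ h]
      exact Or.inl h
    · rw [List.foldl_cons, List.foldl_cons, show stoppedStep Stop F e = greedyStep F e from if_neg h]
      exact ih _

lemma EdgeMatching.foldl_greedyStep {V : Type*} (L : List (Sym2 V)) {F : Finset (Sym2 V)}
    (hF : EdgeMatching F) : EdgeMatching (L.foldl SublinearMatching.greedyStep F) := by
  induction L generalizing F with
  | nil => exact hF
  | cons e L ih => exact ih (hF.greedyStep e)

lemma mem_foldl_greedyStep {V : Type*} (L : List (Sym2 V)) {F : Finset (Sym2 V)} {e : Sym2 V}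
    (he : e ∈ L.foldl greedyStep F) : e ∈ F ∨ e ∈ L := by
  classical
  induction L generalizing F with
  | nil => exact Or.inl he
  | cons a L ih =>
    rcases ih he with h | h
    · by_cases hc : ∃ v ∈ a, v ∈ coveredVerts F
      · rw [greedyStep_of_covered hc] at h
        exact Or.inl h
      · rw [greedyStep_of_free hc, Finset.mem_insert] at h
        rcases h with rfl | h
        · exact Or.inr (by simp)
        · exact Or.inl h
    · exact Or.inr (List.mem_cons_of_mem _ h)

lemma exists_covered_foldl_greedyStep {V : Type*} (L : List (Sym2 V)) (F : Finset (Sym2 V))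
    {e : Sym2 V} (he : e ∈ L) : ∃ v ∈ e, v ∈ coveredVerts (L.foldl greedyStep F) := by
  induction L generalizing F with
  | nil => simp at he
  | cons a L ih =>
    rcases List.mem_cons.mp he with rfl | h
    · obtain ⟨v, hv, hc⟩ := exists_covered_greedyStep F e
      exact ⟨v, hv, coveredVerts_mono (foldl_greedyStep_subset L _) hc⟩
    · exact ih _ h

lemma edgeMatching_greedyMatching {V : Type*} (H : SimpleGraph V) (π : EdgeOrder H) :
    EdgeMatching (greedyMatching H π) :=
  EdgeMatching.foldl_greedyStep _ (by intro e he; simp at he)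

lemma greedyMatching_subset {V : Type*} (H : SimpleGraph V) (π : EdgeOrder H) {e : Sym2 V}
    (he : e ∈ greedyMatching H π) : e ∈ H.edgeSet := by
  rcases mem_foldl_greedyStep _ he with h | h
  · simp at h
  · obtain ⟨i, rfl⟩ := (List.mem_ofFn' _ _).mp h
    exact (π i).2

lemma greedyMatching_maximal {V : Type*} (H : SimpleGraph V) (π : EdgeOrder H) {e : Sym2 V}
    (he : e ∈ H.edgeSet) : ∃ v ∈ e, v ∈ coveredVerts (greedyMatching H π) := by
  apply exists_covered_foldl_greedyStep
  rw [List.mem_ofFn']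
  exact ⟨π.symm ⟨e, he⟩, congrArg Subtype.val (π.apply_symm_apply ⟨e, he⟩)⟩

/-- The greedy matching of the process frozen at `Stop`. -/
noncomputable def stoppedMatching {V : Type*} (H : SimpleGraph V)
    (Stop : Finset (Sym2 V) → Prop) (π : EdgeOrder H) : Finset (Sym2 V) :=
  (List.ofFn fun i => (π i : Sym2 V)).foldl (stoppedStep Stop) ∅

lemma stoppedMatching_subset {V : Type*} (H : SimpleGraph V)
    (Stop : Finset (Sym2 V) → Prop) (π : EdgeOrder H) :
    stoppedMatching H Stop π ⊆ greedyMatching H π := foldl_stoppedStep_subset _ _ _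

lemma stop_stoppedMatching_or_eq {V : Type*} (H : SimpleGraph V)
    (Stop : Finset (Sym2 V) → Prop) (π : EdgeOrder H) :
    Stop (stoppedMatching H Stop π) ∨ stoppedMatching H Stop π = greedyMatching H π :=
  stop_foldl_stoppedStep_or_eq _ _ _

/-- Functionals with non-positive drift along the random greedy process have expectation at most
their initial value at the stopping time. -/
lemma sum_stoppedMatching_le {V : Type*} (H : SimpleGraph V) [Fintype H.edgeSet]
    [Fintype (EdgeOrder H)]
    (Stop : Finset (Sym2 V) → Prop) (Φ : Finset (Sym2 V) → ℝ)
    (hΦ : ∀ F, ¬ Stop F → ∑ e : H.edgeSet, (Φ (greedyStep F e) - Φ F) ≤ 0) :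
    ∑ π : EdgeOrder H, Φ (stoppedMatching H Stop π) ≤ ∑ _π : EdgeOrder H, Φ ∅ := by
  have h := sum_orders_le_of_supermartingale (α := H.edgeSet) (Nat.card H.edgeSet)
    (fun F e => stoppedStep Stop F e) ∅ Φ (fun s e => stoppedStep_idem _ _ _)
    (fun s e e' he => stoppedStep_persist _ _ _ _ he) (by
      intro s
      by_cases hs : Stop s
      · simp [stoppedStep, hs]
      · simpa [stoppedStep, hs] using hΦ s hs)
  refine le_trans (le_of_eq ?_) h
  refine Finset.sum_congr rfl fun π _ => ?_
  unfold stoppedMatching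
  rw [show (List.ofFn fun i => (π i : Sym2 V)) = (List.ofFn π).map Subtype.val by
    rw [List.map_ofFn]; rfl, List.foldl_map]

/-! ### Multiplicities and free copies in the graph of copies -/

open Classical in
/-- The number of edges of `F` between copies of `u` and copies of `w`. -/
noncomputable def edgeCount {V : Type*} {c : V → ℕ} (F : Finset (Sym2 (Σ v : V, Fin (c v))))
    (u w : V) : ℕ :=
  (F.filter fun e => e.map Sigma.fst = s(u, w)).card

open Classical in
/-- The number of copies of `v` that are not covered by `F`. -/
noncomputable def freeCopies {V : Type*} {c : V → ℕ} (F : Finset (Sym2 (Σ v : V, Fin (c v))))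
    (v : V) : ℕ :=
  (Finset.univ.filter fun i : Fin (c v) => (⟨v, i⟩ : Σ v : V, Fin (c v)) ∉ coveredVerts F).card

lemma edgeCount_comm {V : Type*} {c : V → ℕ} (F : Finset (Sym2 (Σ v : V, Fin (c v))))
    (u w : V) : edgeCount F u w = edgeCount F w u := by
  unfold edgeCount
  rw [Sym2.eq_swap]

lemma edgeCount_mono {V : Type*} {c : V → ℕ} {F F' : Finset (Sym2 (Σ v : V, Fin (c v)))}
    (h : F ⊆ F') (u w : V) : edgeCount F u w ≤ edgeCount F' u w := by
  classical
  exact Finset.card_le_card (Finset.filter_subset_filter _ h)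

lemma edgeCount_ne_zero_iff {V : Type*} {c : V → ℕ} (F : Finset (Sym2 (Σ v : V, Fin (c v))))
    (u w : V) : edgeCount F u w ≠ 0 ↔ s(u, w) ∈ projectEdges F := by
  classical
  unfold edgeCount projectEdges
  rw [Finset.card_ne_zero, Multiset.mem_map]
  simp [Finset.Nonempty]

lemma edgeCount_empty {V : Type*} {c : V → ℕ} (u w : V) :
    edgeCount (∅ : Finset (Sym2 (Σ v : V, Fin (c v)))) u w = 0 := by
  simp [edgeCount]

lemma card_filter_greedyStep {V : Type*} {F : Finset (Sym2 V)} {e : Sym2 V}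
    (he : ¬ ∃ v ∈ e, v ∈ coveredVerts F) (p : Sym2 V → Prop)
    [DecidablePred p] :
    ((greedyStep F e).filter p).card = (F.filter p).card + if p e then 1 else 0 := by
  classical
  have he' := notMem_of_free he
  rw [greedyStep_of_free he, Finset.filter_insert]
  split_ifs with h
  · rw [Finset.card_insert_of_notMem (by simp [he'])]
  · rfl

open Classical in
lemma edgeCount_greedyStep {V : Type*} {c : V → ℕ} {F : Finset (Sym2 (Σ v : V, Fin (c v)))}
    {e : Sym2 (Σ v : V, Fin (c v))} (he : ¬ ∃ v ∈ e, v ∈ coveredVerts F) (u w : V) :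
    edgeCount (greedyStep F e) u w =
      edgeCount F u w + if e.map Sigma.fst = s(u, w) then 1 else 0 := by
  unfold edgeCount
  exact card_filter_greedyStep he _

lemma free_mk_iff {V : Type*} {S : Set V} {a b : V} :
    (¬ ∃ v ∈ s(a, b), v ∈ S) ↔ a ∉ S ∧ b ∉ S := by
  simp only [Sym2.mem_iff, not_exists, not_and]
  exact ⟨fun h => ⟨h a (Or.inl rfl), h b (Or.inr rfl)⟩, by rintro ⟨h, h'⟩ v (rfl | rfl) <;> assumption⟩

lemma freeCopies_le {V : Type*} {c : V → ℕ} (F : Finset (Sym2 (Σ v : V, Fin (c v)))) (v : V) :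
    freeCopies F v ≤ c v := by
  classical
  exact (Finset.card_filter_le _ _).trans (by simp)

open Classical in
-- These products are the arrival rates in the drift: an edge over `zw` can still be added exactly
-- when it joins a free copy of `z` to a free copy of `w`.
lemma card_free_edges {V : Type*} [Fintype V] {H : SimpleGraph V} {c : V → ℕ}
    [Fintype (copiesGraph H c).edgeSet] (F : Finset (Sym2 (Σ v : V, Fin (c v)))) {z w : V} (hzw : H.Adj z w) :
    (Finset.univ.filter fun e : (copiesGraph H c).edgeSet =>
      (¬ ∃ v ∈ (e : Sym2 (Σ v : V, Fin (c v))), v ∈ coveredVerts F) ∧ (e : Sym2 (Σ v : V, Fin (c v))).map Sigma.fst = s(z, w)).card =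
      freeCopies F z * freeCopies F w := by
  unfold freeCopies
  rw [← Finset.card_product]
  symm
  refine Finset.card_bij
    (fun p _ => ⟨s((⟨z, p.1⟩ : Σ v : V, Fin (c v)), ⟨w, p.2⟩), hzw⟩) ?_ ?_ ?_
  · intro p hp
    simp only [Finset.mem_product, Finset.mem_filter, Finset.mem_univ, true_and] at hp
    simp only [Finset.mem_filter, Finset.mem_univ, true_and, free_mk_iff]
    exact ⟨hp, rfl⟩
  · intro p _ q _ h
    have h' := congrArg Subtype.val h
    simp only [Sym2.eq_iff, Sigma.mk.injEq] at h'
    rcases h' with ⟨⟨_, h1⟩, _, h2⟩ | ⟨⟨h1, _⟩, _⟩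
    · exact Prod.ext (eq_of_heq h1) (eq_of_heq h2)
    · exact absurd h1 hzw.ne
  · rintro ⟨e, he⟩ h
    induction e with
    | _ x y =>
      obtain ⟨x, i⟩ := x
      obtain ⟨y, j⟩ := y
      simp only [Finset.mem_filter, Finset.mem_univ, true_and, Sym2.map_mk, Sym2.eq_iff,
        free_mk_iff] at h
      obtain ⟨hf, h⟩ := h
      rcases h with ⟨rfl, rfl⟩ | ⟨rfl, rfl⟩
      · refine ⟨(i, j), ?_, rfl⟩
        simpa using hf
      · refine ⟨(j, i), ?_, Subtype.ext Sym2.eq_swap⟩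
        simpa [and_comm] using hf

open Classical in
lemma card_free_edges_of_not_adj {V : Type*} [Fintype V] {H : SimpleGraph V} {c : V → ℕ}
    [Fintype (copiesGraph H c).edgeSet] (F : Finset (Sym2 (Σ v : V, Fin (c v)))) {z w : V} (hzw : ¬ H.Adj z w) :
    (Finset.univ.filter fun e : (copiesGraph H c).edgeSet =>
      (¬ ∃ v ∈ (e : Sym2 (Σ v : V, Fin (c v))), v ∈ coveredVerts F) ∧
        (e : Sym2 (Σ v : V, Fin (c v))).map Sigma.fst = s(z, w)).card = 0 := by
  rw [Finset.card_eq_zero, Finset.filter_eq_empty_iff]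
  rintro ⟨e, he⟩ - ⟨-, h⟩
  induction e with
  | _ x y =>
    have he' : H.Adj x.1 y.1 := he
    simp only [Sym2.map_mk, Sym2.eq_iff] at h
    rcases h with ⟨h1, h2⟩ | ⟨h1, h2⟩ <;> rw [h1, h2] at he'
    · exact hzw he'
    · exact hzw he'.symm

/-! ### Stars do not concentrate before a given edge arrives -/

open Classical in
/-- The potential that controls how concentrated the edges at `z` are before the first edge
between copies of `z` and copies of `y` arrives. -/
noncomputable def starPotential {V : Type*} [Fintype V] {c : V → ℕ} (θ : ℝ) (z y : V)
    (F : Finset (Sym2 (Σ v : V, Fin (c v)))) : ℝ :=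
  (if edgeCount F z y = 0 then ∑ w, ((1 + θ) ^ edgeCount F z w - 1) else 0) -
    θ * ∑ w, (edgeCount F z w : ℝ)

open Classical in
lemma starPotential_greedyStep {V : Type*} [Fintype V] {c : V → ℕ} {θ : ℝ} {z y : V}
    {F : Finset (Sym2 (Σ v : V, Fin (c v)))} (h0 : edgeCount F z y = 0)
    (e : Sym2 (Σ v : V, Fin (c v))) :
    starPotential θ z y (greedyStep F e) - starPotential θ z y F =
      ∑ w, if (¬ ∃ v ∈ e, v ∈ coveredVerts F) ∧ e.map Sigma.fst = s(z, w) then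
        (if w = y then - ∑ w', ((1 + θ) ^ edgeCount F z w' - 1) - θ
          else θ * ((1 + θ) ^ edgeCount F z w - 1)) else 0 := by
  by_cases hf : ∃ v ∈ e, v ∈ coveredVerts F
  · rw [greedyStep_of_covered hf]
    simp [hf]
  · have hins := fun w => edgeCount_greedyStep hf z w
    simp only [hf, not_false_eq_true, true_and]
    by_cases hw : ∃ w, e.map Sigma.fst = s(z, w)
    · obtain ⟨w, hw⟩ := hw
      have hiff : ∀ w', e.map Sigma.fst = s(z, w') ↔ w' = w := by
        intro w'
        rw [hw, Sym2.congr_right, eq_comm]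
      simp only [hiff] at hins
      simp only [hiff, Finset.sum_ite_eq', Finset.mem_univ, if_true]
      have hsum : ∑ w', ((edgeCount (greedyStep F e) z w' : ℕ) : ℝ) =
          ∑ w', (edgeCount F z w' : ℝ) + 1 := by
        simp [hins, Finset.sum_add_distrib]
      unfold starPotential
      rw [hsum]
      by_cases hwy : w = y
      · have : edgeCount (greedyStep F e) z y ≠ 0 := by rw [hins]; simp [hwy]
        rw [if_neg this, if_pos h0, if_pos hwy]
        ring
      · have : edgeCount (greedyStep F e) z y = 0 := by rw [hins, h0]; simp [Ne.symm hwy]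
        rw [if_pos this, if_pos h0, if_neg hwy]
        have h2 : ∑ w', ((1 + θ) ^ edgeCount (greedyStep F e) z w' - 1) =
            ∑ w', ((1 + θ) ^ edgeCount F z w' - 1) + θ * (1 + θ) ^ edgeCount F z w := by
          rw [← sub_eq_iff_eq_add', ← Finset.sum_sub_distrib]
          rw [Finset.sum_eq_single w]
          · rw [hins]; simp [pow_succ]; ring
          · intro b _ hb; rw [hins]; simp [hb]
          · simp
        rw [h2]
        ring
    · push Not at hw
      have : ∀ w, edgeCount (greedyStep F e) z w = edgeCount F z w := by
        intro w
        rw [hins w, if_neg (hw w), add_zero]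
      simp [starPotential, this, hw]

/-- With `X w = (1 + θ) ^ edgeCount F z w - 1`, a new edge over `zw`, `w ≠ y`, changes the potential
by `θ * X w`, the linear term cancelling the remaining `θ`; an edge over `zy` lowers it by `θ` plus
the sum of all `X w`. The rates are in proportion to the free copies of `w`, and `θ * freeCopies F w
≤ θ * c y ≤ freeCopies F y`, so the losses outweigh the gains. -/
lemma starPotential_drift {V : Type*} [Fintype V] {H : SimpleGraph V} {c : V → ℕ}
    [Fintype (copiesGraph H c).edgeSet] {θ : ℝ}
    (hθ : 0 < θ) {z y : V} (hzy : H.Adj z y) (hc : ∀ w, H.Adj z w → c w = c y)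
    (F : Finset (Sym2 (Σ v : V, Fin (c v)))) (h0 : edgeCount F z y = 0)
    (hy : θ * c y ≤ freeCopies F y) :
    ∑ e : (copiesGraph H c).edgeSet,
      (starPotential θ z y (greedyStep F e) - starPotential θ z y F) ≤ 0 := by
  classical
  simp only [starPotential_greedyStep h0]
  rw [Finset.sum_comm]
  simp only [← Finset.sum_filter, Finset.sum_const, nsmul_eq_mul]
  set X : V → ℝ := fun w => (1 + θ) ^ edgeCount F z w - 1 with hX
  have hX0 : ∀ w, 0 ≤ X w := fun w => sub_nonneg.mpr (one_le_pow₀ (by linarith))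
  have hterm : ∀ w ∈ (Finset.univ : Finset V).erase y,
      ((Finset.univ.filter fun e : (copiesGraph H c).edgeSet =>
        (¬ ∃ v ∈ (e : Sym2 (Σ v : V, Fin (c v))), v ∈ coveredVerts F) ∧
          (e : Sym2 (Σ v : V, Fin (c v))).map Sigma.fst = s(z, w)).card : ℝ) *
        (if w = y then - ∑ w', X w' - θ else θ * X w) ≤
      freeCopies F z * freeCopies F y * X w := by
    intro w hw
    rw [if_neg (Finset.ne_of_mem_erase hw)]
    by_cases ha : H.Adj z w
    · rw [card_free_edges F ha]
      have h1 : θ * freeCopies F w ≤ freeCopies F y := by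
        refine le_trans ?_ hy
        gcongr
        exact_mod_cast (freeCopies_le F w).trans (hc w ha).le
      push_cast
      calc (freeCopies F z : ℝ) * freeCopies F w * (θ * X w)
          = freeCopies F z * (θ * freeCopies F w) * X w := by ring
        _ ≤ freeCopies F z * freeCopies F y * X w := by
          have := hX0 w
          gcongr
    · rw [card_free_edges_of_not_adj F ha]
      have := hX0 w
      simp only [Nat.cast_zero, zero_mul]
      positivity
  rw [← Finset.add_sum_erase _ _ (Finset.mem_univ y), if_pos rfl, card_free_edges F hzy]
  have h2 := Finset.sum_le_sum hterm
  rw [← Finset.mul_sum] at h2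
  have h3 : ∑ w ∈ (Finset.univ : Finset V).erase y, X w ≤ ∑ w, X w :=
    Finset.sum_le_sum_of_subset_of_nonneg (Finset.erase_subset _ _) fun w _ _ => hX0 w
  have h4 : (freeCopies F z : ℝ) * freeCopies F y * ∑ w ∈ (Finset.univ : Finset V).erase y, X w ≤
      freeCopies F z * freeCopies F y * ∑ w, X w := by gcongr
  have h5 : 0 ≤ (freeCopies F z : ℝ) * freeCopies F y * θ := by positivity
  push_cast
  linarith

open Classical in
lemma card_copies_mem_edge {V : Type*} [Fintype V] {H : SimpleGraph V} {c : V → ℕ} (z : V)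
    {e : Sym2 (Σ v : V, Fin (c v))} (he : e ∈ (copiesGraph H c).edgeSet) :
    (Finset.univ.filter fun i : Fin (c z) => (⟨z, i⟩ : Σ v : V, Fin (c v)) ∈ e).card =
      ∑ w, if e.map Sigma.fst = s(z, w) then 1 else 0 := by
  induction e with
  | _ x y =>
    obtain ⟨x, i⟩ := x
    obtain ⟨y, j⟩ := y
    have hne : x ≠ y := SimpleGraph.Adj.ne (G := H) he
    simp only [Sym2.map_mk, Sym2.mem_iff, Sigma.mk.injEq]
    by_cases hx : z = x
    · subst hx
      have h : ∀ w, s(z, y) = s(z, w) ↔ y = w := fun w => Sym2.congr_right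
      simp [hne, Finset.filter_eq', h]
    · by_cases hy : z = y
      · subst hy
        have h : ∀ w, s(x, z) = s(z, w) ↔ x = w := fun w => by rw [Sym2.eq_swap, Sym2.congr_right]
        simp [hx, Finset.filter_eq', h]
      · have : ∀ w, ¬ (s(x, y) = s(z, w)) := by
          intro w hw
          rcases Sym2.eq_iff.mp hw with ⟨h, _⟩ | ⟨_, h⟩
          · exact hx h.symm
          · exact hy h.symm
        simp [hx, hy, this]

lemma freeCopies_add_sum_edgeCount {V : Type*} [Fintype V] {H : SimpleGraph V} {c : V → ℕ}
    {F : Finset (Sym2 (Σ v : V, Fin (c v)))} (hF : EdgeMatching F)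
    (hH : ∀ e ∈ F, e ∈ (copiesGraph H c).edgeSet) (z : V) :
    freeCopies F z + ∑ w, edgeCount F z w = c z := by
  classical
  have h1 : ∑ w, edgeCount F z w = ∑ e ∈ F,
      (Finset.univ.filter fun i : Fin (c z) => (⟨z, i⟩ : Σ v : V, Fin (c v)) ∈ e).card := by
    rw [Finset.sum_congr rfl fun e he => card_copies_mem_edge z (hH e he), Finset.sum_comm]
    refine Finset.sum_congr rfl fun w _ => ?_
    unfold edgeCount
    rw [Finset.card_filter]
  have h2 : ∑ e ∈ F,
      (Finset.univ.filter fun i : Fin (c z) => (⟨z, i⟩ : Σ v : V, Fin (c v)) ∈ e).card =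
      ∑ i : Fin (c z), if (⟨z, i⟩ : Σ v : V, Fin (c v)) ∈ coveredVerts F then 1 else 0 := by
    simp_rw [Finset.card_filter]
    rw [Finset.sum_comm]
    refine Finset.sum_congr rfl fun i _ => ?_
    split_ifs with h
    · obtain ⟨e, he, hi⟩ := h
      rw [Finset.sum_eq_single e]
      · rw [if_pos hi]
      · intro e' he' hne
        rw [if_neg]
        intro hi'
        exact hne (hF e' he' e he _ hi' hi)
      · exact fun h => absurd he h
    · refine Finset.sum_eq_zero fun e he => ?_
      rw [if_neg]
      exact fun hi => h ⟨e, he, hi⟩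
  rw [h1, h2]
  unfold freeCopies
  rw [Finset.card_filter, ← Finset.sum_add_distrib]
  rw [Finset.sum_congr rfl (g := fun _ => 1)]
  · simp
  · intro i _
    split_ifs <;> rfl

lemma EdgeMatching.mono {V : Type*} {F F' : Finset (Sym2 V)} (h : F ⊆ F') (hF : EdgeMatching F') :
    EdgeMatching F := fun e he e' he' => hF e (h he) e' (h he')

open Classical in
/-- With high probability, the star at `z` is not concentrated when the process is stopped. -/
lemma card_concentrated_le {V : Type*} [Fintype V] {H : SimpleGraph V} {c : V → ℕ}
    [Fintype (EdgeOrder (copiesGraph H c))] {θ : ℝ}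
    (hθ : 0 < θ) {z y : V} (hzy : H.Adj z y) (hc : ∀ w, H.Adj z w → c w = c y) (hz : 0 < c z)
    (Stop : Finset (Sym2 (Σ v : V, Fin (c v))) → Prop)
    (hStop : ∀ F, ¬ Stop F → edgeCount F z y = 0 ∧ θ * c y ≤ freeCopies F y) :
    ((Finset.univ.filter fun π : EdgeOrder (copiesGraph H c) =>
      edgeCount (stoppedMatching _ Stop π) z y = 0 ∧
        (c z : ℝ) ≤ ∑ w, ((1 + θ) ^ edgeCount (stoppedMatching _ Stop π) z w - 1)).card : ℝ) ≤
      θ * Fintype.card (EdgeOrder (copiesGraph H c)) := by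
  have hsum := sum_stoppedMatching_le (copiesGraph H c) Stop (starPotential θ z y) 
    fun F hF => starPotential_drift hθ hzy hc F (hStop F hF).1 (hStop F hF).2
  have h0 : starPotential θ z y (∅ : Finset (Sym2 (Σ v : V, Fin (c v)))) = 0 := by
    simp [starPotential, edgeCount_empty]
  simp only [h0, Finset.sum_const_zero] at hsum
  have hdeg : ∀ π : EdgeOrder (copiesGraph H c),
      ∑ w, (edgeCount (stoppedMatching _ Stop π) z w : ℝ) ≤ c z := by
    intro π
    have hs := stoppedMatching_subset (copiesGraph H c) Stop π
    have := freeCopies_add_sum_edgeCount (H := H)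
      ((edgeMatching_greedyMatching (copiesGraph H c) π).mono hs)
      (fun e he => greedyMatching_subset _ π (hs he)) z
    exact_mod_cast (Nat.le_add_left _ _).trans this.le
  -- Markov's inequality at level `c z`: the potential starts at 0, so the exponential sum on the
  -- event without `zy` has mean at most `θ` times the mean degree, which is at most `θ * c z`.
  have hterm : ∀ π : EdgeOrder (copiesGraph H c),
      (if edgeCount (stoppedMatching _ Stop π) z y = 0 ∧
        (c z : ℝ) ≤ ∑ w, ((1 + θ) ^ edgeCount (stoppedMatching _ Stop π) z w - 1)
        then (c z : ℝ) else 0) - θ * c z ≤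
      starPotential θ z y (stoppedMatching _ Stop π) := by
    intro π
    have h1 := mul_le_mul_of_nonneg_left (hdeg π) hθ.le
    have h2 : 0 ≤ ∑ w, ((1 + θ) ^ edgeCount (stoppedMatching _ Stop π) z w - 1) :=
      Finset.sum_nonneg fun w _ => sub_nonneg.mpr (one_le_pow₀ (by linarith))
    unfold starPotential
    split_ifs with ha hb hb
    · linarith [ha.2]
    · exact absurd ha.1 hb
    · linarith
    · linarith
  have h3 := (Finset.sum_le_sum fun π (_ : π ∈ Finset.univ) => hterm π).trans hsum
  rw [Finset.sum_sub_distrib, ← Finset.sum_filter, Finset.sum_const, Finset.sum_const,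
    nsmul_eq_mul, nsmul_eq_mul, Finset.card_univ] at h3
  have hz' : (0 : ℝ) < c z := by exact_mod_cast hz
  refine le_of_mul_le_mul_right ?_ hz'
  linarith

/-- The load of `z`, where at most `D` edges to the same vertex are counted. -/
noncomputable def cappedDegree {V : Type*} [Fintype V] {c : V → ℕ} (D : ℝ)
    (F : Finset (Sym2 (Σ v : V, Fin (c v)))) (z : V) : ℝ :=
  ∑ w, min (edgeCount F z w : ℝ) D

/-- A small exponential sum makes every multiplicity logarithmic in `c z`, hence at most `D`, so
capping loses nothing in `s`; having few free copies then means a large capped degree. It can only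
grow from the stopped matching `s` to the final one `F`. -/
lemma le_cappedDegree {V : Type*} [Fintype V] {H : SimpleGraph V} {c : V → ℕ} {θ D : ℝ}
    (hθ : 0 < θ) {z : V} {s F : Finset (Sym2 (Σ v : V, Fin (c v)))} (hsF : s ⊆ F)
    (hs : EdgeMatching s) (hH : ∀ e ∈ s, e ∈ (copiesGraph H c).edgeSet)
    (hD : ∀ n : ℕ, (1 + θ) ^ n < (c z : ℝ) + 1 → (n : ℝ) ≤ D)
    (hlt : ∑ w, ((1 + θ) ^ edgeCount s z w - 1) < (c z : ℝ))
    (hfree : (freeCopies s z : ℝ) < θ * c z) : (1 - θ) * c z ≤ cappedDegree D F z := by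
  have h1 : (freeCopies s z : ℝ) + ∑ w, (edgeCount s z w : ℝ) = c z := by
    exact_mod_cast freeCopies_add_sum_edgeCount hs hH z
  have h2 : ∑ w, (edgeCount s z w : ℝ) ≤ cappedDegree D F z := by
    refine Finset.sum_le_sum fun w _ => le_min ?_ ?_
    · exact_mod_cast edgeCount_mono hsF z w
    · apply hD
      have := Finset.single_le_sum (f := fun w => (1 + θ) ^ edgeCount s z w - 1)
        (fun w _ => sub_nonneg.mpr (one_le_pow₀ (by linarith))) (Finset.mem_univ w)
      linarith
  linarith

open Classical in
/-- With high probability, an edge `zy` is either present in the projection of the random greedy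
matching of the graph of copies, or one of its endpoints is almost saturated by spread-out
edges. -/
lemma card_not_good_le {V : Type*} [Fintype V] {H : SimpleGraph V} {c : V → ℕ}
    [Fintype (EdgeOrder (copiesGraph H c))] {θ D : ℝ}
    (hθ : 0 < θ) {z y : V} (hzy : H.Adj z y) (hcz : ∀ w, H.Adj z w → c w = c y)
    (hcy : ∀ w, H.Adj y w → c w = c z) (hz : 0 < c z) (hy : 0 < c y)
    (hDz : ∀ n : ℕ, (1 + θ) ^ n < (c z : ℝ) + 1 → (n : ℝ) ≤ D)
    (hDy : ∀ n : ℕ, (1 + θ) ^ n < (c y : ℝ) + 1 → (n : ℝ) ≤ D) :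
    ((Finset.univ.filter fun π : EdgeOrder (copiesGraph H c) =>
      ¬ (s(z, y) ∈ projectEdges (greedyMatching _ π) ∨
        (1 - θ) * c z ≤ cappedDegree D (greedyMatching _ π) z ∨
        (1 - θ) * c y ≤ cappedDegree D (greedyMatching _ π) y)).card : ℝ) ≤
      2 * θ * Fintype.card (EdgeOrder (copiesGraph H c)) := by
  -- Before this time the drift condition holds at both ends of `zy`, so the star bound applies to
  -- `z` and, by symmetry, to `y`.
  set Stop : Finset (Sym2 (Σ v : V, Fin (c v))) → Prop := fun F =>
    edgeCount F z y ≠ 0 ∨ (freeCopies F z : ℝ) < θ * c z ∨ (freeCopies F y : ℝ) < θ * c y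
    with hStopdef
  have b1 := card_concentrated_le hθ hzy hcz hz Stop (by
    intro F hF
    simp only [hStopdef, not_or, not_not, not_lt] at hF
    exact ⟨hF.1, hF.2.2⟩)
  have b2 := card_concentrated_le hθ hzy.symm hcy hy Stop (by
    intro F hF
    simp only [hStopdef, not_or, not_not, not_lt] at hF
    exact ⟨(edgeCount_comm F y z).trans hF.1, hF.2.1⟩)
  have hsub : (Finset.univ.filter fun π : EdgeOrder (copiesGraph H c) =>
      ¬ (s(z, y) ∈ projectEdges (greedyMatching _ π) ∨
        (1 - θ) * c z ≤ cappedDegree D (greedyMatching _ π) z ∨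
        (1 - θ) * c y ≤ cappedDegree D (greedyMatching _ π) y)) ⊆
      (Finset.univ.filter fun π : EdgeOrder (copiesGraph H c) =>
        edgeCount (stoppedMatching _ Stop π) z y = 0 ∧
        (c z : ℝ) ≤ ∑ w, ((1 + θ) ^ edgeCount (stoppedMatching _ Stop π) z w - 1)) ∪
      (Finset.univ.filter fun π : EdgeOrder (copiesGraph H c) =>
        edgeCount (stoppedMatching _ Stop π) y z = 0 ∧
        (c y : ℝ) ≤ ∑ w, ((1 + θ) ^ edgeCount (stoppedMatching _ Stop π) y w - 1)) := by
    intro π hπ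
    simp only [Finset.mem_filter, Finset.mem_univ, true_and, Finset.mem_union] at hπ ⊢
    by_contra hcon
    apply hπ
    simp only [not_or, not_and, not_le] at hcon
    obtain ⟨hc1, hc2⟩ := hcon
    set s := stoppedMatching (copiesGraph H c) Stop π with hs
    have hsF : s ⊆ greedyMatching _ π := stoppedMatching_subset _ _ _
    have hsM : EdgeMatching s := (edgeMatching_greedyMatching _ π).mono hsF
    have hsH : ∀ e ∈ s, e ∈ (copiesGraph H c).edgeSet :=
      fun e he => greedyMatching_subset _ π (hsF he)
    by_cases h0 : edgeCount s z y = 0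
    · right
      have h0' : edgeCount s y z = 0 := (edgeCount_comm s y z).trans h0
      have hfree : (freeCopies s z : ℝ) < θ * c z ∨ (freeCopies s y : ℝ) < θ * c y := by
        rcases stop_stoppedMatching_or_eq (copiesGraph H c) Stop π with h | h
        · exact h.resolve_left (not_not.mpr h0)
        -- If the process ran to its end with free copies on both sides, an edge over `zy` could
        -- still be added, against maximality.
        · by_contra hcon
          simp only [not_or, not_lt] at hcon
          have hp1 : 0 < freeCopies s z := by
            have : (0 : ℝ) < freeCopies s z := lt_of_lt_of_le (by positivity) hcon.1
            exact_mod_cast this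
          have hp2 : 0 < freeCopies s y := by
            have : (0 : ℝ) < freeCopies s y := lt_of_lt_of_le (by positivity) hcon.2
            exact_mod_cast this
          obtain ⟨i, hi⟩ := Finset.card_pos.mp hp1
          obtain ⟨j, hj⟩ := Finset.card_pos.mp hp2
          rw [Finset.mem_filter] at hi hj
          have hmax := greedyMatching_maximal (copiesGraph H c) π
            (e := s((⟨z, i⟩ : Σ v : V, Fin (c v)), ⟨y, j⟩)) hzy
          rw [← h] at hmax
          exact free_mk_iff.mpr ⟨hi.2, hj.2⟩ hmax
      rcases hfree with hfree | hfree
      · exact Or.inl (le_cappedDegree hθ hsF hsM hsH hDz (hc1 h0) hfree)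
      · exact Or.inr (le_cappedDegree hθ hsF hsM hsH hDy (hc2 h0') hfree)
    · left
      rw [← edgeCount_ne_zero_iff]
      have := edgeCount_mono hsF z y
      omega
  have hcard : ((Finset.univ.filter fun π : EdgeOrder (copiesGraph H c) =>
      ¬ (s(z, y) ∈ projectEdges (greedyMatching _ π) ∨
        (1 - θ) * c z ≤ cappedDegree D (greedyMatching _ π) z ∨
        (1 - θ) * c y ≤ cappedDegree D (greedyMatching _ π) y)).card : ℝ) ≤ _ :=
    Nat.cast_le.mpr ((Finset.card_le_card hsub).trans (Finset.card_union_le _ _))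
  push_cast at hcard
  linarith

/-! ### Hall's theorem with deficiency -/

/-- Hall's theorem with deficiency `d`. -/
lemma exists_partial_matching_of_deficiency {ι α : Type*} [Fintype ι] [DecidableEq α]
    (t : ι → Finset α) (d : ℕ) (h : ∀ s : Finset ι, s.card ≤ (s.biUnion t).card + d) :
    ∃ f : ι → Option α, (∀ i j a, f i = some a → f j = some a → i = j) ∧
      (∀ i a, f i = some a → a ∈ t i) ∧ (Finset.univ.filter fun i => f i = none).card ≤ d := by
  classical
  -- All indices get the same `d` dummy partners; the indices matched to dummies are the unmatched
  -- ones.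
  have hall := (Finset.all_card_le_biUnion_card_iff_exists_injective
    (fun i => (t i).disjSum (Finset.univ : Finset (Fin d)))).mp (by
      intro s
      rcases s.eq_empty_or_nonempty with rfl | hs
      · simp
      · have : s.biUnion (fun i => (t i).disjSum (Finset.univ : Finset (Fin d))) =
            (s.biUnion t).disjSum Finset.univ := by
          obtain ⟨i₀, hi₀⟩ := hs
          ext (a | b)
          · simp
          · simp only [Finset.mem_biUnion, Finset.inr_mem_disjSum, Finset.mem_univ, and_true]
            exact iff_of_true ⟨i₀, hi₀⟩ trivial
        rw [this, Finset.card_disjSum]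
        simpa using h s)
  obtain ⟨g, hg, hgt⟩ := hall
  refine ⟨fun i => (g i).getLeft?, ?_, ?_, ?_⟩
  · intro i j a hi hj
    rw [Sum.getLeft?_eq_some_iff] at hi hj
    exact hg (hi.trans hj.symm)
  · intro i a hi
    rw [Sum.getLeft?_eq_some_iff] at hi
    have := hgt i
    rw [hi] at this
    simpa using this
  · have := Finset.card_le_card_of_injOn (s := Finset.univ.filter fun i => (g i).getLeft? = none)
      (t := (Finset.univ : Finset (Fin d)).map ⟨Sum.inr (α := α), Sum.inr_injective⟩) g (by
        intro i hi
        simp only [Finset.coe_filter, Finset.mem_univ, true_and, Set.mem_ofPred_eq,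
          Sum.getLeft?_eq_none_iff, Sum.isRight_iff] at hi
        obtain ⟨b, hb⟩ := hi
        simp [hb]) hg.injOn
    simpa using this

/-! ### Independent coins -/

/-- The indicator of the event that coin `i` shows heads. -/
def coin {I : Type*} (S : I → Bool) (i : I) : ℝ := if S i then 1 else 0

/-- The probability of the outcome `S` of independent coins with biases `q`. -/
def coinWeight {I : Type*} [Fintype I] (q : I → ℝ) (S : I → Bool) : ℝ :=
  ∏ i, if S i then q i else 1 - q i

open Classical in
/-- The expectation over independent coins with biases `q`. -/
noncomputable def coinExp {I : Type*} [Fintype I] (q : I → ℝ) (f : (I → Bool) → ℝ) : ℝ :=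
  ∑ S : I → Bool, coinWeight q S * f S

section Coins
variable {I : Type*} [Fintype I] {q : I → ℝ}

lemma coinExp_add (f g : (I → Bool) → ℝ) :
    coinExp q (fun S => f S + g S) = coinExp q f + coinExp q g := by
  simp [coinExp, mul_add, Finset.sum_add_distrib]

lemma coinExp_mul_left (a : ℝ) (f : (I → Bool) → ℝ) :
    coinExp q (fun S => a * f S) = a * coinExp q f := by
  simp only [coinExp, Finset.mul_sum]
  exact Finset.sum_congr rfl fun S _ => by ring

lemma coinExp_sub (f g : (I → Bool) → ℝ) :
    coinExp q (fun S => f S - g S) = coinExp q f - coinExp q g := by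
  simp [coinExp, mul_sub, Finset.sum_sub_distrib]

lemma coinExp_sum {J : Type*} (s : Finset J) (f : J → (I → Bool) → ℝ) :
    coinExp q (fun S => ∑ j ∈ s, f j S) = ∑ j ∈ s, coinExp q (f j) := by
  simp only [coinExp, Finset.mul_sum]
  rw [Finset.sum_comm]

/-- Independence enters here; the first and second moments are the cases where `T` has at most two
elements. -/
lemma coinExp_prod_coin (T : Finset I) :
    coinExp q (fun S => ∏ i ∈ T, coin S i) = ∏ i ∈ T, q i := by
  classical
  have h1 : ∀ S : I → Bool, coinWeight q S * ∏ i ∈ T, coin S i =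
      ∏ i, (fun (i : I) (b : Bool) => (if b then q i else 1 - q i) *
        if i ∈ T then (if b then 1 else 0) else 1) i (S i) := by
    intro S
    rw [Finset.prod_mul_distrib]
    congr 1
    simp only [coin]
    rw [Finset.prod_ite_mem, Finset.univ_inter]
  have h2 := Finset.prod_univ_sum (fun _ : I => (Finset.univ : Finset Bool))
    (fun (i : I) (b : Bool) => (if b then q i else 1 - q i) *
        if i ∈ T then (if b then 1 else 0) else 1)
  rw [Fintype.piFinset_univ] at h2
  unfold coinExp
  rw [Finset.sum_congr rfl fun S _ => h1 S]
  refine Eq.trans ?_ (h2.symm.trans ?_)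
  · congr!
  · rw [← Finset.univ_inter T, ← Finset.prod_ite_mem]
    refine Finset.prod_congr rfl fun i _ => ?_
    by_cases hi : i ∈ T <;> simp [hi]

lemma coinExp_const (a : ℝ) : coinExp q (fun _ => a) = a := by
  have := coinExp_mul_left (q := q) a (fun _ => ∏ i ∈ (∅ : Finset I), coin (fun _ => true) i)
  have h2 := coinExp_prod_coin (q := q) ∅
  simp only [Finset.prod_empty] at this h2
  simpa [h2] using this

lemma coinExp_coin (i : I) : coinExp q (fun S => coin S i) = q i := by
  simpa using coinExp_prod_coin (q := q) {i}

lemma coinExp_coin_mul_coin {i j : I} (h : i ≠ j) :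
    coinExp q (fun S => coin S i * coin S j) = q i * q j := by
  classical
  simpa [Finset.prod_pair h] using coinExp_prod_coin (q := q) {i, j}

lemma coinExp_mono (h0 : ∀ i, 0 ≤ q i) (h1 : ∀ i, q i ≤ 1) {f g : (I → Bool) → ℝ}
    (h : ∀ S, f S ≤ g S) : coinExp q f ≤ coinExp q g := by
  refine Finset.sum_le_sum fun S _ => mul_le_mul_of_nonneg_left (h S) ?_
  refine Finset.prod_nonneg fun i _ => ?_
  split_ifs
  · exact h0 i
  · exact sub_nonneg.mpr (h1 i)

lemma exists_coinExp_le (h0 : ∀ i, 0 ≤ q i) (h1 : ∀ i, q i ≤ 1) (f : (I → Bool) → ℝ) :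
    ∃ S, coinExp q f ≤ f S := by
  classical
  by_contra! hcon
  obtain ⟨S, -, hS⟩ := Finset.exists_max_image (Finset.univ : Finset (I → Bool)) f
    Finset.univ_nonempty
  have := coinExp_mono h0 h1 (f := f) (g := fun _ => f S) (fun S' => hS S' (Finset.mem_univ _))
  rw [coinExp_const] at this
  exact absurd (hcon S) (not_lt.mpr this)

lemma coinExp_centered_mul (i j : I) [Decidable (i = j)] :
    coinExp q (fun S => (coin S i - q i) * (coin S j - q j)) =
      if i = j then q i * (1 - q i) else 0 := by
  have h : (fun S : I → Bool => (coin S i - q i) * (coin S j - q j)) =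
      fun S => (coin S i * coin S j - q j * coin S i) - (q i * coin S j - q i * q j) := by
    funext S; ring
  rw [h, coinExp_sub, coinExp_sub, coinExp_sub, coinExp_mul_left, coinExp_mul_left, coinExp_const,
    coinExp_coin, coinExp_coin]
  split_ifs with hij
  · subst hij
    have : (fun S : I → Bool => coin S i * coin S i) = fun S => coin S i := by
      funext S; unfold coin; split_ifs <;> simp
    rw [this, coinExp_coin]
    ring
  · rw [coinExp_coin_mul_coin hij]
    ring

/-- The variance of a linear combination of independent coins. -/
lemma coinExp_sq_sub (a : I → ℝ) :
    coinExp q (fun S => (∑ i, a i * coin S i - ∑ i, a i * q i) ^ 2) =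
      ∑ i, a i ^ 2 * (q i * (1 - q i)) := by
  classical
  have h : (fun S : I → Bool => (∑ i, a i * coin S i - ∑ i, a i * q i) ^ 2) =
      fun S => ∑ i, ∑ j, (a i * a j) * ((coin S i - q i) * (coin S j - q j)) := by
    funext S
    rw [← Finset.sum_sub_distrib, sq, Finset.sum_mul_sum]
    exact Finset.sum_congr rfl fun i _ => Finset.sum_congr rfl fun j _ => by ring
  rw [h, coinExp_sum]
  refine Finset.sum_congr rfl fun i _ => ?_
  rw [coinExp_sum, Finset.sum_eq_single i]
  · rw [coinExp_mul_left, coinExp_centered_mul, if_pos rfl]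
    ring
  · intro j _ hj
    rw [coinExp_mul_left, coinExp_centered_mul, if_neg (Ne.symm hj), mul_zero]
  · simp

end Coins

/-! ### Rounding a fractional matching with small entries -/

open Classical in
/-- A nearly perfect fractional bipartite matching yields a nearly perfect matching. -/
lemma exists_partial_matching_of_fractional {ι W : Type*} [Fintype ι] [Fintype W]
    (y : ι → W → ℝ) (hy : ∀ i w, 0 ≤ y i w) (adj : ι → W → Prop)
    (hadj : ∀ i w, y i w ≠ 0 → adj i w) (O : Finset W) :
    ∃ f : ι → Option W, (∀ i j w, f i = some w → f j = some w → i = j) ∧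
      (∀ i w, f i = some w → w ∈ O ∧ adj i w) ∧
      ((Finset.univ.filter fun i => f i = none).card : ℝ) ≤
        ∑ i, |1 - ∑ w ∈ O, y i w| + ∑ w, max (∑ i, y i w - 1) 0 := by
  set D := ∑ i, |1 - ∑ w ∈ O, y i w| + ∑ w, max (∑ i, y i w - 1) 0 with hD
  have hD0 : 0 ≤ D := add_nonneg (Finset.sum_nonneg fun i _ => abs_nonneg _)
    (Finset.sum_nonneg fun w _ => le_max_right _ _)
  obtain ⟨f, h1, h2, h3⟩ := exists_partial_matching_of_deficiency
    (fun i => O.filter fun w => adj i w) ⌊D⌋₊ (by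
      intro Z
      set N := Z.biUnion fun i => O.filter fun w => adj i w with hN
      -- The mass sent from `Z` into `O` lands in the neighbourhood `N`, where each vertex carries
      -- at most 1 plus its excess.
      have hs : ∑ i ∈ Z, ∑ w ∈ O, y i w ≤ N.card + ∑ w, max (∑ i, y i w - 1) 0 := by
        have e1 : ∀ i ∈ Z, ∑ w ∈ O, y i w = ∑ w ∈ N, if w ∈ O then y i w else 0 := by
          intro i hi
          rw [← Finset.sum_filter]
          symm
          refine Finset.sum_subset_zero_on_sdiff ?_ ?_ (fun _ _ => rfl)
          · intro w hw
            exact (Finset.mem_filter.mp hw).2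
          · intro w hw
            rw [Finset.mem_sdiff] at hw
            by_contra hne
            apply hw.2
            rw [Finset.mem_filter]
            refine ⟨Finset.mem_biUnion.mpr ⟨i, hi, ?_⟩, hw.1⟩
            exact Finset.mem_filter.mpr ⟨hw.1, hadj i w hne⟩
        rw [Finset.sum_congr rfl e1, Finset.sum_comm]
        have e2 : ∀ w ∈ N, (∑ i ∈ Z, if w ∈ O then y i w else 0) ≤
            1 + max (∑ i, y i w - 1) 0 := by
          intro w _
          have a1 : (∑ i ∈ Z, if w ∈ O then y i w else 0) ≤ ∑ i ∈ Z, y i w := by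
            refine Finset.sum_le_sum fun i _ => ?_
            split_ifs
            · exact le_rfl
            · exact hy i w
          have a2 : ∑ i ∈ Z, y i w ≤ ∑ i, y i w :=
            Finset.sum_le_sum_of_subset_of_nonneg (Finset.subset_univ _) fun i _ _ => hy i w
          have a3 := le_max_left (∑ i, y i w - 1) 0
          linarith
        refine (Finset.sum_le_sum e2).trans ?_
        rw [Finset.sum_add_distrib, Finset.sum_const, nsmul_eq_mul, mul_one]
        exact add_le_add le_rfl (Finset.sum_le_sum_of_subset_of_nonneg (Finset.subset_univ _)
          fun _ _ _ => le_max_right _ _)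
      have hz : (Z.card : ℝ) - ∑ i ∈ Z, ∑ w ∈ O, y i w ≤ ∑ i, |1 - ∑ w ∈ O, y i w| := by
        have : (Z.card : ℝ) - ∑ i ∈ Z, ∑ w ∈ O, y i w = ∑ i ∈ Z, (1 - ∑ w ∈ O, y i w) := by
          simp [Finset.sum_sub_distrib]
        rw [this]
        refine (Finset.sum_le_sum fun i _ => le_abs_self _).trans ?_
        exact Finset.sum_le_sum_of_subset_of_nonneg (Finset.subset_univ _)
          fun i _ _ => abs_nonneg _
      have hle : (Z.card : ℝ) - N.card ≤ D := by linarith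
      have : Z.card - N.card ≤ ⌊D⌋₊ := by
        rcases le_total N.card Z.card with h | h
        · rw [Nat.le_floor_iff hD0, Nat.cast_sub h]
          exact hle
        · simp [Nat.sub_eq_zero_of_le h]
      omega)
  refine ⟨f, h1, fun i w h => Finset.mem_filter.mp (h2 i w h), ?_⟩
  refine le_trans ?_ (Nat.floor_le hD0)
  exact_mod_cast h3

lemma abs_le_add_sq_div {η t : ℝ} (hη : 0 < η) : |t| ≤ η + t ^ 2 / η := by
  rcases le_total |t| η with h | h
  · have : 0 ≤ t ^ 2 / η := by positivity
    linarith
  · have : |t| ≤ t ^ 2 / η := by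
      rw [le_div_iff₀ hη, ← sq_abs]
      nlinarith [abs_nonneg t]
    linarith

/-- If `t` exceeds `μ` by at least `η`, the quadratic term pays. Otherwise `t > 1` forces `μ ≥ 1/2`,
so the excess is at most `η ≤ 2 * η * μ`. An error proportional to `μ` is essential: summed over all
of `W` it is bounded by the total load, not by the size of `W`. -/
lemma max_sub_one_le {η μ t : ℝ} (hη : 0 < η) (hη' : η ≤ 1 / 2) (hμ0 : 0 ≤ μ) (hμ : μ ≤ 1) :
    max (t - 1) 0 ≤ 2 * η * μ + (t - μ) ^ 2 / η := by
  have h0 : 0 ≤ (t - μ) ^ 2 / η := by positivity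
  refine max_le ?_ (by positivity)
  rcases le_total (t - μ) η with h | h
  · rcases le_total t 1 with ht | ht
    · have : 0 ≤ 2 * η * μ := by positivity
      linarith
    · have : 1 / 2 ≤ μ := by linarith
      nlinarith
  · have : t - μ ≤ (t - μ) ^ 2 / η := by
      rw [le_div_iff₀ hη]
      nlinarith
    have : 0 ≤ 2 * η * μ := by positivity
    linarith

section Rounding
variable {P W : Type*} [Fintype P] [Fintype W]

/-- The biases of the coins: pair `p` is active with probability `ρ p`, and `w` is reserved with
probability `1 - o w`. -/
def roundingBias (ρ : P → ℝ) (o : W → ℝ) : P ⊕ W → ℝ := Sum.elim ρ fun w => 1 - o w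

/-- Here `1 - coin` indicates that `w` is not reserved. Entries at most `θ ^ 4` give variance at
most `θ ^ 4`, and deviation scale `θ ^ 2` balances the two error terms. -/
lemma coinExp_supply_error {θ : ℝ} (hθ : 0 < θ) {ρ : P → ℝ} {o : W → ℝ}
    (hρ0 : ∀ p, 0 ≤ ρ p) (hρ1 : ∀ p, ρ p ≤ 1)
    (ho : ∀ w, θ ≤ o w) (ho1 : ∀ w, o w ≤ 1) (y : W → ℝ) (hy0 : ∀ w, 0 ≤ y w)
    (hy : ∀ w, y w ≤ θ ^ 4) (hsum : ∑ w, y w * o w = 1) :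
    coinExp (roundingBias ρ o) (fun S => |1 - ∑ w, y w * (1 - coin S (Sum.inr w))|) ≤
      2 * θ ^ 2 := by
  have hq0 : ∀ i, 0 ≤ roundingBias ρ o i := by
    rintro (p | w)
    · exact hρ0 p
    · exact sub_nonneg.mpr (ho1 w)
  have hq1 : ∀ i, roundingBias ρ o i ≤ 1 := by
    rintro (p | w)
    · exact hρ1 p
    · have := ho w
      simp only [roundingBias, Sum.elim_inr]
      linarith
  have hη : 0 < θ ^ 2 := by positivity
  refine (coinExp_mono hq0 hq1 fun S => abs_le_add_sq_div hη).trans ?_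
  have h1 := coinExp_sq_sub (q := roundingBias ρ o) (Sum.elim (fun _ : P => 0) y)
  simp only [Fintype.sum_sum_type, Sum.elim_inl, Sum.elim_inr, zero_mul, Finset.sum_const_zero,
    zero_add, ne_eq, OfNat.ofNat_ne_zero, not_false_eq_true, zero_pow] at h1
  have h2 : ∀ S : P ⊕ W → Bool, (1 - ∑ w, y w * (1 - coin S (Sum.inr w))) =
      ∑ w, y w * coin S (Sum.inr w) - ∑ w, y w * roundingBias ρ o (Sum.inr w) := by
    intro S
    rw [show (1 : ℝ) - ∑ w, y w * (1 - coin S (Sum.inr w)) =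
      ∑ w, y w * o w - ∑ w, y w * (1 - coin S (Sum.inr w)) by rw [hsum]]
    simp only [roundingBias, Sum.elim_inr, ← Finset.sum_sub_distrib]
    exact Finset.sum_congr rfl fun w _ => by ring
  simp only [h2, div_eq_inv_mul]
  rw [coinExp_add, coinExp_const, coinExp_mul_left, h1]
  have h3 : ∑ w, y w ^ 2 * (roundingBias ρ o (Sum.inr w) * (1 - roundingBias ρ o (Sum.inr w))) ≤
      θ ^ 4 * ∑ w, y w * o w := by
    rw [Finset.mul_sum]
    refine Finset.sum_le_sum fun w _ => ?_
    simp only [roundingBias, Sum.elim_inr, sub_sub_cancel]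
    have b0 := hy0 w
    have b1 := hy w
    have b2 := ho w
    have b3 : 0 ≤ o w := by linarith
    calc y w ^ 2 * ((1 - o w) * o w) ≤ y w ^ 2 * (1 * o w) := by gcongr; linarith
      _ = y w * (y w * o w) := by ring
      _ ≤ θ ^ 4 * (y w * o w) := by gcongr
  rw [hsum, mul_one] at h3
  have h4 : (θ ^ 2)⁻¹ * θ ^ 4 = θ ^ 2 := by field_simp
  have h5 := mul_le_mul_of_nonneg_left h3 (inv_nonneg.mpr hη.le)
  linarith

/-- The entries may reach `2 * θ ^ 4` because both ends of a pair share one coin. The bound stays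
proportional to the load `l`, as needed for summing over `W`. -/
lemma coinExp_load_error {θ : ℝ} (hθ : 0 < θ) (hθ1 : θ ≤ 1 / 2) {ρ : P → ℝ} {o : W → ℝ}
    (hρ0 : ∀ p, 0 ≤ ρ p) (hρ1 : ∀ p, ρ p ≤ 1)
    (ho : ∀ w, θ ≤ o w) (ho1 : ∀ w, o w ≤ 1) (g : P → ℝ) (hg0 : ∀ p, 0 ≤ g p)
    (hg : ∀ p, g p ≤ 2 * θ ^ 4) {l : ℝ} (hl : ∑ p, g p * ρ p ≤ l / θ) (hl1 : ∑ p, g p * ρ p ≤ 1) :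
    coinExp (roundingBias ρ o) (fun S => max (∑ p, g p * coin S (Sum.inl p) - 1) 0) ≤
      4 * θ * l := by
  have hq0 : ∀ i, 0 ≤ roundingBias ρ o i := by
    rintro (p | w)
    · exact hρ0 p
    · exact sub_nonneg.mpr (ho1 w)
  have hq1 : ∀ i, roundingBias ρ o i ≤ 1 := by
    rintro (p | w)
    · exact hρ1 p
    · have := ho w
      simp only [roundingBias, Sum.elim_inr]
      linarith
  have hη : 0 < θ ^ 2 := by positivity
  set μ := ∑ p, g p * ρ p with hμ
  have hμ0 : 0 ≤ μ := Finset.sum_nonneg fun p _ => mul_nonneg (hg0 p) (hρ0 p)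
  refine (coinExp_mono hq0 hq1 fun S =>
    max_sub_one_le hη (by nlinarith) hμ0 hl1).trans ?_
  have h1 := coinExp_sq_sub (q := roundingBias ρ o) (Sum.elim g (fun _ : W => 0))
  simp only [Fintype.sum_sum_type, Sum.elim_inl, Sum.elim_inr, zero_mul, Finset.sum_const_zero,
    add_zero, ne_eq, OfNat.ofNat_ne_zero, not_false_eq_true, zero_pow] at h1
  have h1' : coinExp (roundingBias ρ o) (fun S => (∑ p, g p * coin S (Sum.inl p) - μ) ^ 2) =
      ∑ p, g p ^ 2 * (ρ p * (1 - ρ p)) := h1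
  simp only [div_eq_inv_mul]
  rw [coinExp_add, coinExp_const, coinExp_mul_left, h1']
  have h3 : ∑ p, g p ^ 2 * (ρ p * (1 - ρ p)) ≤ 2 * θ ^ 4 * μ := by
    rw [hμ, Finset.mul_sum]
    refine Finset.sum_le_sum fun p _ => ?_
    have b0 := hg0 p
    have b1 := hg p
    have b2 := hρ0 p
    calc g p ^ 2 * (ρ p * (1 - ρ p)) ≤ g p ^ 2 * (ρ p * 1) := by gcongr; linarith
      _ = g p * (g p * ρ p) := by ring
      _ ≤ 2 * θ ^ 4 * (g p * ρ p) := by gcongr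
  have h4 : (θ ^ 2)⁻¹ * (2 * θ ^ 4 * μ) = 2 * θ ^ 2 * μ := by field_simp
  have h5 := mul_le_mul_of_nonneg_left h3 (inv_nonneg.mpr hη.le)
  have h6 : 4 * θ ^ 2 * μ ≤ 4 * θ ^ 2 * (l / θ) := by gcongr
  have h7 : 4 * θ ^ 2 * (l / θ) = 4 * θ * l := by field_simp
  linarith

end Rounding

lemma prod_coin_eq_ite {I : Type*} (S : I → Bool) (T : Finset I) [Decidable (∀ i ∈ T, S i = true)] :
    ∏ i ∈ T, coin S i = if ∀ i ∈ T, S i = true then 1 else 0 := by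
  split_ifs with h
  · exact Finset.prod_eq_one fun i hi => by simp [coin, h i hi]
  · push Not at h
    obtain ⟨i, hi, hS⟩ := h
    exact Finset.prod_eq_zero hi (by simp [coin, hS])

open Classical in
/-- For a fixed outcome `S` of the coins, all active pairs whose room ends have reserved mates can
be matched, up to the deficiency of the fractional matching `y`. -/
lemma exists_matching_of_outcome {P W : Type*} [Fintype P] [Fintype W]
    (adj : P × Bool → W → Prop) (light : Finset (P × Bool)) (on : Finset P) (mate : P × Bool → W)
    (hmate : ∀ e e', e.1 ∈ on → e ∉ light → e'.1 ∈ on → e' ∉ light → mate e = mate e' → e = e')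
    (hmate_adj : ∀ e, e.1 ∈ on → e ∉ light → adj e (mate e))
    (y : P × Bool → W → ℝ) (hy0 : ∀ e w, 0 ≤ y e w) (hyadj : ∀ e w, y e w ≠ 0 → adj e w)
    (T : P → Finset (P ⊕ W))
    (hTl : ∀ p ∈ on, ∀ b, (p, b) ∈ light → Sum.inl p ∈ T p)
    (hTr : ∀ p ∈ on, ∀ b, (p, b) ∉ light → Sum.inr (mate (p, b)) ∈ T p)
    (S : P ⊕ W → Bool) :
    ∃ f : P × Bool → Option W, (∀ e e' w, f e = some w → f e' = some w → e = e') ∧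
      (∀ e w, f e = some w → adj e w) ∧
      ∑ p ∈ on, ∏ i ∈ T p, coin S i ≤
        ((Finset.univ.filter fun p => (f (p, false)).isSome ∧ (f (p, true)).isSome).card : ℝ) +
        (∑ e ∈ light, |1 - ∑ w, y e w * (1 - coin S (Sum.inr w))| +
          ∑ w, max (∑ e ∈ light, y e w * coin S (Sum.inl e.1) - 1) 0) := by
  -- `A` consists of the active light ends and `O` of the unreserved vertices.
  set A := light.filter fun e => S (Sum.inl e.1) = true with hA
  set O : Finset W := Finset.univ.filter fun w => S (Sum.inr w) = false with hO
  obtain ⟨h, h1, h2, h3⟩ := exists_partial_matching_of_fractional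
    (fun (e : A) w => y e w) (fun e w => hy0 e w) (fun e w => adj e w) (fun e w => hyadj e w) O
  have hcard : ((Finset.univ.filter fun i : A => h i = none).card : ℝ) ≤
      (∑ e ∈ light, |1 - ∑ w, y e w * (1 - coin S (Sum.inr w))| +
          ∑ w, max (∑ e ∈ light, y e w * coin S (Sum.inl e.1) - 1) 0) := by
    refine h3.trans (add_le_add ?_ (le_of_eq ?_))
    · have e1 : ∀ e : P × Bool, ∑ w ∈ O, y e w = ∑ w, y e w * (1 - coin S (Sum.inr w)) := by
        intro e
        rw [hO, Finset.sum_filter]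
        refine Finset.sum_congr rfl fun w _ => ?_
        cases hS : S (Sum.inr w) <;> simp [coin, hS]
      simp only [e1]
      rw [Finset.sum_coe_sort A fun e => |1 - ∑ w, y e w * (1 - coin S (Sum.inr w))|]
      exact Finset.sum_le_sum_of_subset_of_nonneg (Finset.filter_subset _ _)
        fun _ _ _ => abs_nonneg _
    · refine Finset.sum_congr rfl fun w _ => ?_
      rw [Finset.sum_coe_sort A fun e => y e w, hA, Finset.sum_filter]
      congr 2
      refine Finset.sum_congr rfl fun e _ => ?_
      cases hS : S (Sum.inl e.1) <;> simp [coin, hS]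
  -- Light ends use unreserved vertices and the others reserved mates, so the two families cannot
  -- collide.
  set f : P × Bool → Option W := fun e => if he : e ∈ A then h ⟨e, he⟩ else
    if e.1 ∈ on ∧ e ∉ light ∧ S (Sum.inr (mate e)) = true then some (mate e) else none with hf
  have hf1 : ∀ e (he : e ∈ A), f e = h ⟨e, he⟩ := fun e he => dif_pos he
  have hf2 : ∀ e w, e ∉ A → f e = some w →
      e.1 ∈ on ∧ e ∉ light ∧ S (Sum.inr w) = true ∧ mate e = w := by
    intro e w he hw
    simp only [hf, dif_neg he] at hw
    split_ifs at hw with hc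
    · rw [Option.some_inj] at hw
      exact ⟨hc.1, hc.2.1, hw ▸ hc.2.2, hw⟩
  refine ⟨f, ?_, ?_, ?_⟩
  · intro e e' w he he'
    by_cases ha : e ∈ A <;> by_cases ha' : e' ∈ A
    · rw [hf1 _ ha] at he
      rw [hf1 _ ha'] at he'
      exact congrArg Subtype.val (h1 _ _ _ he he')
    · rw [hf1 _ ha] at he
      have a1 := (Finset.mem_filter.mp (h2 _ _ he).1).2
      rw [(hf2 _ _ ha' he').2.2.1] at a1
      cases a1
    · rw [hf1 _ ha'] at he'
      have a1 := (Finset.mem_filter.mp (h2 _ _ he').1).2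
      rw [(hf2 _ _ ha he).2.2.1] at a1
      cases a1
    · obtain ⟨a1, a2, -, a3⟩ := hf2 _ _ ha he
      obtain ⟨b1, b2, -, b3⟩ := hf2 _ _ ha' he'
      exact hmate e e' a1 a2 b1 b2 (a3.trans b3.symm)
  · intro e w he
    by_cases ha : e ∈ A
    · rw [hf1 _ ha] at he
      exact (h2 _ _ he).2
    · obtain ⟨a1, a2, -, a3⟩ := hf2 _ _ ha he
      exact a3 ▸ hmate_adj e a1 a2
  · refine le_trans ?_ (add_le_add le_rfl hcard)
    simp only [prod_coin_eq_ite]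
    rw [← Finset.sum_filter, Finset.sum_const, nsmul_eq_mul, mul_one]
    -- A pair whose coins all show heads can fail only through an active light end left unmatched by
    -- `h`.
    have hsub : (on.filter fun p => ∀ i ∈ T p, S i = true) ⊆
        (Finset.univ.filter fun p => (f (p, false)).isSome ∧ (f (p, true)).isSome) ∪
        (Finset.univ.filter fun i : A => h i = none).image fun i => i.1.1 := by
      intro p hp
      rw [Finset.mem_filter] at hp
      rw [Finset.mem_union, Finset.mem_filter]
      by_contra hcon
      rw [not_or] at hcon
      have hend : ∀ b, (f (p, b)).isSome := by
        intro b
        by_contra hnone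
        rw [Option.not_isSome_iff_eq_none] at hnone
        by_cases hl : (p, b) ∈ light
        · have ha : (p, b) ∈ A := Finset.mem_filter.mpr ⟨hl, hp.2 _ (hTl p hp.1 b hl)⟩
          apply hcon.2
          rw [Finset.mem_image]
          refine ⟨⟨(p, b), ha⟩, ?_, rfl⟩
          rw [hf1 _ ha] at hnone
          simpa using hnone
        · have ha : (p, b) ∉ A := fun h => hl (Finset.mem_filter.mp h).1
          simp only [hf, dif_neg ha] at hnone
          rw [if_pos ⟨hp.1, hl, hp.2 _ (hTr p hp.1 b hl)⟩] at hnone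
          cases hnone
      exact hcon.1 ⟨Finset.mem_univ _, hend false, hend true⟩
    have := (Finset.card_le_card hsub).trans (Finset.card_union_le _ _)
    have h4 := Finset.card_image_le (s := Finset.univ.filter fun i : A => h i = none)
      (f := fun i => i.1.1)
    exact_mod_cast this.trans (Nat.add_le_add_left h4 _)

open Classical in
-- With `y = x / (l * o)` each light end has expected supply 1, and since `ρ ≤ l` each `w` has
-- expected load at most `(∑ x) / o ≤ 1`. Some outcome of the coins is at least as good as the mean.
-- Supply and load errors cost at most `4 * θ` per pair each.
lemma exists_matching_of_modes {P W : Type*} [Fintype P] [Fintype W] {θ : ℝ} (hθ : 0 < θ)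
    (hθ1 : θ ≤ 1 / 2) (x : P × Bool → W → ℝ) (hx0 : ∀ e w, 0 ≤ x e w)
    (hxθ : ∀ e w, x e w ≤ θ ^ 6) (adj : P × Bool → W → Prop)
    (hadj : ∀ e w, x e w ≠ 0 → adj e w) (hl : ∀ e, ∑ w, x e w ≤ 1 / 2)
    (light : Finset (P × Bool)) (on : Finset P) (mate : P × Bool → W)
    (hlight : ∀ e ∈ light, θ ≤ ∑ w, x e w)
    (hmate : ∀ e e', e.1 ∈ on → e ∉ light → e'.1 ∈ on → e' ∉ light → mate e = mate e' → e = e')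
    (hmate_adj : ∀ e, e.1 ∈ on → e ∉ light → adj e (mate e))
    (ρ : P → ℝ) (hρ0 : ∀ p, 0 ≤ ρ p) (hρ1 : ∀ p, ρ p ≤ 1)
    (hρ : ∀ e ∈ light, ρ e.1 ≤ ∑ w, x e w)
    (o : W → ℝ) (ho : ∀ w, θ ≤ o w) (ho1 : ∀ w, o w ≤ 1) (hxo : ∀ w, ∑ e, x e w ≤ o w)
    (T : P → Finset (P ⊕ W))
    (hTl : ∀ p ∈ on, ∀ b, (p, b) ∈ light → Sum.inl p ∈ T p)
    (hTr : ∀ p ∈ on, ∀ b, (p, b) ∉ light → Sum.inr (mate (p, b)) ∈ T p) :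
    ∃ f : P × Bool → Option W, (∀ e e' w, f e = some w → f e' = some w → e = e') ∧
      (∀ e w, f e = some w → adj e w) ∧
      ∑ p ∈ on, ∏ i ∈ T p, roundingBias ρ o i - 8 * θ * Fintype.card P ≤
        ((Finset.univ.filter fun p => (f (p, false)).isSome ∧ (f (p, true)).isSome).card : ℝ) := by
  set l : P × Bool → ℝ := fun e => ∑ w, x e w with hldef
  set y : P × Bool → W → ℝ := fun e w => x e w / (l e * o w) with hydef
  have hl0 : ∀ e, 0 ≤ l e := fun e => Finset.sum_nonneg fun w _ => hx0 e w
  have ho0 : ∀ w, 0 < o w := fun w => hθ.trans_le (ho w)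
  have hy0 : ∀ e w, 0 ≤ y e w := fun e w =>
    div_nonneg (hx0 e w) (mul_nonneg (hl0 e) (ho0 w).le)
  have hyθ : ∀ e ∈ light, ∀ w, y e w ≤ θ ^ 4 := by
    intro e he w
    have a1 := hlight e he
    have a2 := ho w
    have hpos : 0 < l e * o w := mul_pos (hθ.trans_le a1) (ho0 w)
    rw [hydef]
    dsimp only
    rw [div_le_iff₀ hpos]
    have : θ * θ ≤ l e * o w := mul_le_mul a1 a2 hθ.le (hl0 e)
    calc x e w ≤ θ ^ 6 := hxθ e w
      _ = θ ^ 4 * (θ * θ) := by ring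
      _ ≤ θ ^ 4 * (l e * o w) := by gcongr
  have hq0 : ∀ i, 0 ≤ roundingBias ρ o i := by
    rintro (p | w)
    · exact hρ0 p
    · exact sub_nonneg.mpr (ho1 w)
  have hq1 : ∀ i, roundingBias ρ o i ≤ 1 := by
    rintro (p | w)
    · exact hρ1 p
    · have := ho0 w
      simp only [roundingBias, Sum.elim_inr]
      linarith
  obtain ⟨S, hS⟩ := exists_coinExp_le hq0 hq1 (fun S => ∑ p ∈ on, ∏ i ∈ T p, coin S i -
    (∑ e ∈ light, |1 - ∑ w, y e w * (1 - coin S (Sum.inr w))| +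
          ∑ w, max (∑ e ∈ light, y e w * coin S (Sum.inl e.1) - 1) 0))
  obtain ⟨f, hf1, hf2, hf3⟩ := exists_matching_of_outcome adj light on mate hmate hmate_adj y hy0
    (fun e w h => hadj e w fun h0 => h (by simp [hydef, h0])) T hTl hTr S
  refine ⟨f, hf1, hf2, ?_⟩
  rw [coinExp_sub, coinExp_sum, coinExp_add, coinExp_sum, coinExp_sum] at hS
  simp only [coinExp_prod_coin] at hS
  have hsup : ∑ e ∈ light, coinExp (roundingBias ρ o)
      (fun S => |1 - ∑ w, y e w * (1 - coin S (Sum.inr w))|) ≤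
      ∑ e ∈ light, 2 * θ ^ 2 := by
    refine Finset.sum_le_sum fun e he => ?_
    refine coinExp_supply_error hθ hρ0 hρ1 ho ho1 (y e) (hy0 e) (hyθ e he) ?_
    have hle : l e ≠ 0 := (hθ.trans_le (hlight e he)).ne'
    have : ∀ w, y e w * o w = x e w / l e := by
      intro w
      have := (ho0 w).ne'
      simp only [hydef]
      field_simp
    simp only [this]
    rw [← Finset.sum_div]
    exact div_self hle
  have hlightcard : (light.card : ℝ) ≤ 2 * Fintype.card P := by
    have := Finset.card_le_univ light
    rw [Fintype.card_prod, Fintype.card_bool] at this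
    have h' : (light.card : ℝ) ≤ (Fintype.card P * 2 : ℕ) := by exact_mod_cast this
    push_cast at h'
    linarith
  have hload : ∑ w, coinExp (roundingBias ρ o)
      (fun S => max (∑ e ∈ light, y e w * coin S (Sum.inl e.1) - 1) 0) ≤
      ∑ w, 4 * θ * ∑ e, x e w := by
    refine Finset.sum_le_sum fun w _ => ?_
    set g : P → ℝ := fun p => ∑ b, if (p, b) ∈ light then y (p, b) w else 0 with hg
    have hconv : ∀ c : P → ℝ, ∑ e ∈ light, y e w * c e.1 = ∑ p, g p * c p := by
      intro c
      rw [← Finset.univ_inter light, ← Finset.sum_ite_mem, Fintype.sum_prod_type]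
      refine Finset.sum_congr rfl fun p _ => ?_
      simp only [hg, Finset.sum_mul, ite_mul, zero_mul]
    have hμ : ∑ p, g p * ρ p ≤ (∑ e, x e w) / o w := by
      rw [← hconv]
      have : ∀ e ∈ light, y e w * ρ e.1 ≤ x e w / o w := by
        intro e he
        have hle : 0 < l e := hθ.trans_le (hlight e he)
        calc y e w * ρ e.1 ≤ y e w * l e := mul_le_mul_of_nonneg_left (hρ e he) (hy0 e w)
          _ = x e w / o w := by
            have := (ho0 w).ne'
            simp only [hydef]
            field_simp
      refine (Finset.sum_le_sum this).trans ?_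
      rw [← Finset.sum_div]
      have := ho0 w
      gcongr
      · exact fun _ _ _ => hx0 _ _
      · exact Finset.subset_univ _
    have hxw : 0 ≤ ∑ e, x e w := Finset.sum_nonneg fun e _ => hx0 e w
    have := coinExp_load_error hθ hθ1 hρ0 hρ1 ho ho1 g
      (fun p => Finset.sum_nonneg fun b _ => by
        split_ifs
        · exact hy0 _ _
        · exact le_rfl)
      (fun p => by
        have : ∀ b, (if (p, b) ∈ light then y (p, b) w else 0) ≤ θ ^ 4 := by
          intro b
          split_ifs with h
          · exact hyθ _ h w
          · positivity
        simp only [hg, Fintype.sum_bool]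
        linarith [this true, this false])
      (l := ∑ e, x e w)
      (hμ.trans (div_le_div_of_nonneg_left hxw hθ (ho w)))
      (hμ.trans ((div_le_one (ho0 w)).mpr (hxo w)))
    refine le_trans (le_of_eq ?_) this
    congr 1
    funext S
    rw [hconv fun p => coin S (Sum.inl p)]
  have htot : ∑ w, ∑ e, x e w ≤ Fintype.card P := by
    rw [Finset.sum_comm]
    refine (Finset.sum_le_sum fun e _ => hl e).trans (le_of_eq ?_)
    simp
  rw [← Finset.mul_sum] at hload
  rw [Finset.sum_const, nsmul_eq_mul] at hsup
  have b1 : (light.card : ℝ) * (2 * θ ^ 2) ≤ 2 * Fintype.card P * (2 * θ ^ 2) := by gcongr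
  have b2 : 4 * θ * ∑ w, ∑ e, x e w ≤ 4 * θ * Fintype.card P := by gcongr
  have b3 : 2 * (Fintype.card P : ℝ) * (2 * θ ^ 2) ≤ 4 * θ * Fintype.card P := by
    have : θ ^ 2 ≤ θ := by nlinarith
    have hc : (0 : ℝ) ≤ Fintype.card P := by positivity
    nlinarith
  linarith

/-! ### Choosing how to serve each pair -/

lemma sqrt_two_bounds : (1.4142 : ℝ) < √2 ∧ √2 < 1.4143 ∧ √2 * √2 = 2 := by
  refine ⟨?_, ?_, Real.mul_self_sqrt (by norm_num)⟩
  · exact Real.lt_sqrt_of_sq_lt (by norm_num)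
  · rw [Real.sqrt_lt' (by norm_num)]
    norm_num

/-- The four ways of serving a pair whose ends have loads `a, b` and whose mates have residual
capacities `c, d`. -/
lemma exists_good_mode {θ a b c d : ℝ} (hθ : 0 < θ) (hθ1 : θ ≤ 1 / 10) (Ru Rv : Prop)
    (ha0 : 0 ≤ a) (ha : a ≤ √2 - 1) (hb0 : 0 ≤ b) (hb : b ≤ √2 - 1)
    (hc0 : 0 ≤ c) (hc : c ≤ 1) (hd0 : 0 ≤ d) (hd : d ≤ 1)
    (hu : Ru ∨ √2 - 1 - θ ≤ a ∨ c ≤ θ) (hv : Rv ∨ √2 - 1 - θ ≤ b ∨ d ≤ θ) :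
    ((1 - √2 / 2) * (a + b + c + d - √2) ≤ min a b + 2 * θ) ∨
    (Rv ∧ (1 - √2 / 2) * (a + b + c + d - √2) ≤ a * d + 2 * θ) ∨
    (Ru ∧ (1 - √2 / 2) * (a + b + c + d - √2) ≤ b * c + 2 * θ) ∨
    (Ru ∧ Rv ∧ (1 - √2 / 2) * (a + b + c + d - √2) ≤ c * d + 2 * θ) := by
  obtain ⟨h1, h2, h3⟩ := sqrt_two_bounds
  generalize √2 = s at *
  have hκ : 0 < 1 - s / 2 := by linarith
  have hκ3 : ∀ t, 0 ≤ t → (1 - s / 2) * t ≤ 3 / 10 * t := fun t ht =>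
    mul_le_mul_of_nonneg_right (by linarith) ht
  have hcd : c + d - 1 ≤ c * d := by nlinarith
  have had : a + d - 1 ≤ a * d := by nlinarith
  have hbc : b + c - 1 ≤ b * c := by nlinarith
  have key : ∀ t, a + b + c + d - s ≤ t →
      (1 - s / 2) * (a + b + c + d - s) ≤ (1 - s / 2) * t :=
    fun t ht => mul_le_mul_of_nonneg_left ht hκ.le
  -- One end, with load `a'`, is nearly saturated. At the threshold `b' = (s - 1) * d'` both
  -- alternatives are tight, since there `(1 - s / 2) * (b' + d') = b'`; this dictates the constant
  -- `1 - √2 / 2`.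
  have hlight : ∀ {a' b' d' : ℝ}, 0 ≤ b' → 0 ≤ d' → d' ≤ 1 → s - 1 - θ ≤ a' → b' ≤ s - 1 →
      ((1 - s / 2) * (b' + d') ≤ min a' b' + 2 * θ ∨ (1 - s / 2) * (b' + d') ≤ a' * d' + 2 * θ) := by
    intro a' b' d' hb0' hd0' hd1' ha' hb'
    rcases le_total ((s - 1) * d') b' with h | h
    · left
      have : d' ≤ (1 + s) * b' := by nlinarith
      have h5 : (1 - s / 2) * (b' + d') ≤ b' := by nlinarith
      have : b' - θ ≤ min a' b' := le_min (by linarith) (by linarith)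
      linarith
    · right
      have h5 : (1 - s / 2) * (b' + d') ≤ (s - 1) * d' := by nlinarith
      have : (s - 1 - θ) * d' ≤ a' * d' := mul_le_mul_of_nonneg_right ha' hd0'
      nlinarith
  rcases hu with hu | hu | hu <;> rcases hv with hv | hv | hv
  · have hc' : 0 ≤ c * d := mul_nonneg hc0 hd0
    have hmin : ∀ m, 0 ≤ m → a + b + c + d - s ≤ m + c * d →
        (1 - s / 2) * (a + b + c + d - s) ≤ m ∨ (1 - s / 2) * (a + b + c + d - s) ≤ c * d := by
      intro m hm0 hm
      have := key _ hm
      have h6 := hκ3 _ (add_nonneg hm0 hc')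
      rcases le_total m (c * d) with h | h
      · right; linarith
      · left; linarith
    rcases hmin (min a b) (le_min ha0 hb0) (by
      rcases le_total a b with h | h
      · rw [min_eq_left h]; linarith
      · rw [min_eq_right h]; linarith) with h | h
    · left; linarith
    · exact Or.inr (Or.inr (Or.inr ⟨hu, hv, by linarith⟩))
  · have := key (a + c) (by linarith)
    rcases hlight ha0 hc0 hc hv ha with h | h
    · left; rw [min_comm]; linarith
    · right; right; left; exact ⟨hu, by linarith⟩
  · have h5 := key (b * c + θ) (by linarith)
    have : 0 ≤ b * c := mul_nonneg hb0 hc0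
    have h6 := hκ3 (b * c + θ) (by positivity)
    right; right; left; exact ⟨hu, by linarith⟩
  · have := key (b + d) (by linarith)
    rcases hlight hb0 hd0 hd hu hb with h | h
    · left; linarith
    · right; left; exact ⟨hv, by linarith⟩
  -- Both ends are nearly saturated: the sum is at most `s`, and `(1 - s / 2) * s = s - 1` makes
  -- this case tight as well.
  · left
    have := key s (by linarith)
    have h5 : s - 1 - θ ≤ min a b := le_min hu hv
    have h6 : (1 - s / 2) * s = s - 1 := by linear_combination (-1 / 2 : ℝ) * h3
    linarith
  · left
    have := key (b + θ) (by linarith)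
    have h5 : (1 - s / 2) * b ≤ min a b :=
      le_min (by linarith [hκ3 b hb0]) (by linarith [hκ3 b hb0])
    have h6 := hκ3 θ hθ.le
    linarith
  · have h5 := key (a * d + θ) (by linarith)
    have : 0 ≤ a * d := mul_nonneg ha0 hd0
    have h6 := hκ3 (a * d + θ) (by positivity)
    exact Or.inr (Or.inl ⟨hv, by linarith⟩)
  · left
    have := key (a + θ) (by linarith)
    have h5 : (1 - s / 2) * a ≤ min a b :=
      le_min (by linarith [hκ3 a ha0]) (by linarith [hκ3 a ha0])
    have h6 := hκ3 θ hθ.le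
    linarith
  · left
    have := key (2 * θ) (by linarith)
    have h5 : 0 ≤ min a b := le_min ha0 hb0
    have h6 := hκ3 (2 * θ) (by positivity)
    linarith

/-- The rounding divides by the probability of being unreserved, so that probability is kept at
least `θ`; this is the price for two mates. -/
lemma mul_sub_le_of_max {θ c d lc ld : ℝ} (hθ : 0 < θ) (hθ1 : θ ≤ 1) (hc : c = 1 - lc)
    (hd : d = 1 - ld) (hlc0 : 0 ≤ lc) (hld0 : 0 ≤ ld) (hlc : lc ≤ 1) (hld : ld ≤ 1) :
    c * d - 2 * θ ≤ (1 - max lc θ) * (1 - max ld θ) := by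
  subst hc hd
  have h1 : max lc θ ≤ lc + θ := max_le (by linarith) (by linarith)
  have h2 : max ld θ ≤ ld + θ := max_le (by linarith) (by linarith)
  have h3 : lc ≤ max lc θ := le_max_left _ _
  have h4 : ld ≤ max ld θ := le_max_left _ _
  have h5 : max lc θ ≤ 1 := max_le hlc hθ1
  have h6 : max ld θ ≤ 1 := max_le hld hθ1
  nlinarith [mul_nonneg (sub_nonneg.mpr h5) (sub_nonneg.mpr h2),
    mul_nonneg (sub_nonneg.mpr hld) (sub_nonneg.mpr h1)]

open Classical in
/-- Choice of a mode for one pair: `act` says whether the pair is used, and `lt b` whether its end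
`b` is matched through its light edges or to its mate. -/
lemma exists_pair_mode {W : Type*} {θ : ℝ} (hθ : 0 < θ) (hθ1 : θ ≤ 1 / 10)
    (l : Bool → ℝ) (hl0 : ∀ b, 0 ≤ l b) (hl : ∀ b, l b ≤ √2 - 1)
    (lw : W → ℝ) (hlw0 : ∀ w, 0 ≤ lw w) (hlw : ∀ w, lw w ≤ 1) (mate : Bool → W)
    (T : Bool → Prop) (R : Bool → Prop)
    (c : Bool → ℝ) (hcT : ∀ b, T b → c b = 1 - lw (mate b)) (hcN : ∀ b, ¬ T b → c b = 0)
    (hT : ∀ b, T b → R b ∨ √2 - 1 - θ ≤ l b ∨ 1 - θ ≤ lw (mate b)) :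
    ∃ (act : Prop) (lt : Bool → Prop) (ρ : ℝ), 0 ≤ ρ ∧ ρ ≤ 1 ∧
      (act → ∀ b, lt b → θ ≤ l b ∧ ρ ≤ l b) ∧ (act → ∀ b, ¬ lt b → T b ∧ R b) ∧
      (¬ act → (1 - √2 / 2) * (l false + l true + c false +
        c true - √2) ≤ 4 * θ) ∧
      (act → (1 - √2 / 2) * (l false + l true + c false +
        c true - √2) - 4 * θ ≤
        (if lt false ∨ lt true then ρ else 1) *
        ((if lt false then 1 else 1 - max (lw (mate false)) θ) *
          if lt true then 1 else 1 - max (lw (mate true)) θ)) := by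
  obtain ⟨h1, h2, h3⟩ := sqrt_two_bounds
  have hc0 : ∀ b, 0 ≤ c b := by
    intro b
    by_cases h : T b
    · rw [hcT b h]
      exact sub_nonneg.mpr (hlw _)
    · rw [hcN b h]
  have hc1 : ∀ b, c b ≤ 1 := by
    intro b
    have := hlw0 (mate b)
    by_cases h : T b
    · linarith [hcT b h]
    · linarith [hcN b h]
  have hcase : ∀ b, (T b ∧ R b) ∨ √2 - 1 - θ ≤ l b ∨
      c b ≤ θ := by
    intro b
    by_cases hb : T b
    · rcases hT b hb with h | h | h
      · exact Or.inl ⟨hb, h⟩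
      · exact Or.inr (Or.inl h)
      · rw [hcT b hb]
        exact Or.inr (Or.inr (by linarith))
    · rw [hcN b hb]
      exact Or.inr (Or.inr hθ.le)
  have hres : ∀ b, T b → c b - θ ≤ 1 - max (lw (mate b)) θ := by
    intro b hb
    rw [hcT b hb]
    have := hlw0 (mate b)
    have : max (lw (mate b)) θ ≤ lw (mate b) + θ := max_le (by linarith) (by linarith)
    linarith
  have hmode := exists_good_mode hθ hθ1 (T false ∧ R false) (T true ∧ R true) (hl0 false)
    (hl false) (hl0 true) (hl true) (hc0 false) (hc1 false) (hc0 true) (hc1 true) (hcase false)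
    (hcase true)
  have hc1f := hc1 false
  have hc1t := hc1 true
  have hc0f := hc0 false
  have hc0t := hc0 true
  rcases hmode with h | ⟨hR, h⟩ | ⟨hR, h⟩ | ⟨hRu, hRv, h⟩
  -- Rounding needs light ends of load at least `θ`. Below that the mode is worth at most `θ`, and
  -- the pair can stay idle within the allowed error; likewise in the two mixed modes.
  · by_cases hm : θ ≤ min (l false) (l true)
    · refine ⟨True, fun _ => True, min (l false) (l true), le_min (hl0 _) (hl0 _),
        (min_le_left _ _).trans (by linarith [hl false]), ?_, ?_, ?_, ?_⟩
      · rintro - (_ | _) -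
        · exact ⟨hm.trans (min_le_left _ _), min_le_left _ _⟩
        · exact ⟨hm.trans (min_le_right _ _), min_le_right _ _⟩
      · exact fun _ b hb => absurd trivial hb
      · exact fun h => absurd trivial h
      · intro _
        simp only [true_or, if_true, mul_one]
        linarith
    · refine ⟨False, fun _ => True, 0, le_rfl, zero_le_one, False.elim, False.elim, ?_, False.elim⟩
      intro _
      push Not at hm
      linarith
  · by_cases hm : θ ≤ l false
    · refine ⟨True, fun b => b = false, l false, hl0 _, by linarith [hl false], ?_, ?_, ?_, ?_⟩
      · rintro - b rfl
        exact ⟨hm, le_rfl⟩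
      · rintro - (_ | _) hb
        · exact absurd rfl hb
        · exact hR
      · exact fun h => absurd trivial h
      · intro _
        have h5 := mul_le_mul_of_nonneg_left (hres true hR.1) (hl0 false)
        have h6 := hl0 false
        have h7 := hl false
        simp only [true_or, if_true, one_mul, Bool.true_eq_false, if_false]
        nlinarith
    · refine ⟨False, fun _ => True, 0, le_rfl, zero_le_one, False.elim, False.elim, ?_, False.elim⟩
      intro _
      push Not at hm
      nlinarith [hl0 false]
  · by_cases hm : θ ≤ l true
    · refine ⟨True, fun b => b = true, l true, hl0 _, by linarith [hl true], ?_, ?_, ?_, ?_⟩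
      · rintro - b rfl
        exact ⟨hm, le_rfl⟩
      · rintro - (_ | _) hb
        · exact hR
        · exact absurd rfl hb
      · exact fun h => absurd trivial h
      · intro _
        have h5 := mul_le_mul_of_nonneg_left (hres false hR.1) (hl0 true)
        have h6 := hl0 true
        have h7 := hl true
        simp only [or_true, if_true, mul_one, Bool.false_eq_true, if_false]
        nlinarith
    · refine ⟨False, fun _ => True, 0, le_rfl, zero_le_one, False.elim, False.elim, ?_, False.elim⟩
      intro _
      push Not at hm
      nlinarith [hl0 true]
  · refine ⟨True, fun _ => False, 1, zero_le_one, le_rfl, fun _ b hb => hb.elim, ?_, ?_, ?_⟩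
    · rintro - (_ | _) -
      · exact hRu
      · exact hRv
    · exact fun h => absurd trivial h
    · intro _
      have h5 := mul_sub_le_of_max (θ := θ) (c := c false)
        (d := c true) hθ (by linarith) (hcT _ hRu.1)
        (hcT _ hRv.1) (hlw0 _) (hlw0 _) (hlw _) (hlw _)
      simp only [or_self, if_false, one_mul]
      linarith

open Classical in
/-- The deterministic core: from a light fractional `b`-matching `x` and a set `T` of ends with
mates, one gets a matching that covers both ends of many pairs. -/
theorem exists_augmentation {P W : Type*} [Fintype P] [Fintype W] {θ : ℝ} (hθ : 0 < θ)
    (hθ1 : θ ≤ 1 / 10) (x : P × Bool → W → ℝ) (hx0 : ∀ e w, 0 ≤ x e w)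
    (hxθ : ∀ e w, x e w ≤ θ ^ 6) (adj : P × Bool → W → Prop)
    (hadj : ∀ e w, x e w ≠ 0 → adj e w) (hl : ∀ e, ∑ w, x e w ≤ √2 - 1)
    (hw : ∀ w, ∑ e, x e w ≤ 1) (T : Finset (P × Bool)) (mate : P × Bool → W)
    (hmate : ∀ e ∈ T, ∀ e' ∈ T, mate e = mate e' → e = e')
    (hT : ∀ e ∈ T, adj e (mate e) ∨ √2 - 1 - θ ≤ ∑ w, x e w ∨ 1 - θ ≤ ∑ e', x e' (mate e)) :
    ∃ f : P × Bool → Option W, (∀ e e' w, f e = some w → f e' = some w → e = e') ∧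
      (∀ e w, f e = some w → adj e w) ∧
      (1 - √2 / 2) * T.card - (√2 - 1) * Fintype.card P - 12 * θ * Fintype.card P ≤
        ((Finset.univ.filter fun p => (f (p, false)).isSome ∧ (f (p, true)).isSome).card : ℝ) := by
  obtain ⟨h1, h2, h3⟩ := sqrt_two_bounds
  set l : P × Bool → ℝ := fun e => ∑ w, x e w with hldef
  set lw : W → ℝ := fun w => ∑ e, x e w with hlwdef
  have hlw0 : ∀ w, 0 ≤ lw w := fun w => Finset.sum_nonneg fun e _ => hx0 e w
  have hpm := fun p => exists_pair_mode hθ hθ1 (fun b => l (p, b))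
    (fun b => Finset.sum_nonneg fun w _ => hx0 (p, b) w) (fun b => hl (p, b)) lw hlw0 hw
    (fun b => mate (p, b)) (fun b => (p, b) ∈ T) (fun b => adj (p, b) (mate (p, b)))
    (fun b => if (p, b) ∈ T then 1 - lw (mate (p, b)) else 0) (fun b hb => if_pos hb)
    (fun b hb => if_neg hb) (fun b hb => hT (p, b) hb)
  choose act lt ρ hρ0 hρ1 hact1 hact2 hact3 hact4 using hpm
  set on : Finset P := Finset.univ.filter act with hon
  set light : Finset (P × Bool) := Finset.univ.filter fun e => act e.1 ∧ lt e.1 e.2 with hlight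
  set o : W → ℝ := fun w => max (lw w) θ with ho
  -- As `Tp p` is a set, a pair with two light ends pays for its coin only once.
  set Tp : P → Finset (P ⊕ W) := fun p => Finset.univ.image fun b : Bool =>
    if lt p b then Sum.inl p else Sum.inr (mate (p, b)) with hTp
  have hmem_on : ∀ p, p ∈ on ↔ act p := by simp [hon]
  have hmem_light : ∀ p b, (p, b) ∈ light ↔ act p ∧ lt p b := by simp [hlight]
  have hroom : ∀ e : P × Bool, e.1 ∈ on → e ∉ light → e ∈ T ∧ adj e (mate e) := by
    rintro ⟨p, b⟩ ha hb
    rw [hmem_on] at ha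
    rw [hmem_light] at hb
    exact hact2 p ha b fun h => hb ⟨ha, h⟩
  obtain ⟨f, hf1, hf2, hf3⟩ := exists_matching_of_modes hθ (by linarith) x hx0 hxθ adj hadj
    (fun e => (hl e).trans (by linarith)) light on mate
    (by
      rintro ⟨p, b⟩ he
      rw [hmem_light] at he
      exact (hact1 p he.1 b he.2).1)
    (fun e e' he1 he2 he1' he2' h =>
      hmate e (hroom e he1 he2).1 e' (hroom e' he1' he2').1 h)
    (fun e he1 he2 => (hroom e he1 he2).2) ρ hρ0 hρ1
    (by
      rintro ⟨p, b⟩ he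
      rw [hmem_light] at he
      exact (hact1 p he.1 b he.2).2)
    o (fun w => le_max_right _ _) (fun w => max_le (hw w) (by linarith))
    (fun w => le_max_left _ _) Tp
    (by
      intro p _ b hb
      rw [hmem_light] at hb
      exact Finset.mem_image.mpr ⟨b, Finset.mem_univ _, if_pos hb.2⟩)
    (by
      intro p hp b hb
      rw [hmem_light] at hb
      exact Finset.mem_image.mpr ⟨b, Finset.mem_univ _,
        if_neg fun h => hb ⟨(hmem_on p).mp hp, h⟩⟩)
  refine ⟨f, hf1, hf2, le_trans ?_ hf3⟩
  set c : P × Bool → ℝ := fun e => if e ∈ T then 1 - lw (mate e) else 0 with hc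
  have hterm : ∀ p, (1 - √2 / 2) * (l (p, false) + l (p, true) + c (p, false) + c (p, true) - √2) -
      4 * θ ≤ if p ∈ on then ∏ i ∈ Tp p, roundingBias ρ o i else 0 := by
    intro p
    by_cases hp : act p
    · rw [if_pos ((hmem_on p).mpr hp)]
      refine (hact4 p hp).trans (le_of_eq ?_)
      have himg : Tp p = {if lt p true then Sum.inl p else Sum.inr (mate (p, true)),
          if lt p false then Sum.inl p else Sum.inr (mate (p, false))} := by
        rw [hTp]
        dsimp only
        rw [Fintype.univ_bool, Finset.image_insert, Finset.image_singleton]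
      rw [himg]
      by_cases ht : lt p true <;> by_cases hf : lt p false
      · simp [ht, hf, roundingBias]
      · rw [Finset.prod_pair (by simp [ht, hf])]
        simp [ht, hf, roundingBias, ho]
      · rw [Finset.prod_pair (by simp [ht, hf])]
        simp [ht, hf, roundingBias, ho, mul_comm]
      · rw [Finset.prod_pair]
        · simp [ht, hf, roundingBias, ho, mul_comm]
        · simp only [ht, hf, if_false]
          intro h
          have := hmate _ (hact2 p hp true ht).1 _ (hact2 p hp false hf).1 (Sum.inr_injective h)
          simp at this
    · rw [if_neg fun h => hp ((hmem_on p).mp h)]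
      linarith [hact3 p hp]
  have hsum := Finset.sum_le_sum fun p (_ : p ∈ Finset.univ) => hterm p
  rw [Finset.sum_ite_mem, Finset.univ_inter, Finset.sum_sub_distrib, ← Finset.mul_sum] at hsum
  have hl_tot : ∑ p, (l (p, false) + l (p, true) + c (p, false) + c (p, true) - √2) =
      ∑ e, l e + ∑ e, c e - √2 * Fintype.card P := by
    rw [Fintype.sum_prod_type, Fintype.sum_prod_type]
    simp only [Fintype.sum_bool]
    rw [Finset.sum_sub_distrib, ← Finset.sum_add_distrib, Finset.sum_const, nsmul_eq_mul,
      Finset.card_univ, mul_comm (√2)]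
    congr 1
    exact Finset.sum_congr rfl fun p _ => by ring
  -- Distinct mates lose at most the total load on `W`, which equals the total load of the ends; so
  -- loads plus residual capacities amount to at least `T.card`.
  have hc_tot : (T.card : ℝ) - ∑ e, l e ≤ ∑ e, c e := by
    have e1 : ∑ e, c e = ∑ e ∈ T, (1 - lw (mate e)) := by
      rw [hc, Finset.sum_ite_mem, Finset.univ_inter]
    have e2 : ∑ e ∈ T, lw (mate e) ≤ ∑ w, lw w := by
      rw [← Finset.sum_image (f := lw) (g := mate) fun e he e' he' => hmate e he e' he']
      exact Finset.sum_le_sum_of_subset_of_nonneg (Finset.subset_univ _) fun w _ _ => hlw0 w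
    have e3 : ∑ w, lw w = ∑ e, l e := Finset.sum_comm
    rw [e1, Finset.sum_sub_distrib, Finset.sum_const, nsmul_eq_mul, mul_one]
    linarith
  rw [hl_tot, Finset.sum_const, nsmul_eq_mul, Finset.card_univ] at hsum
  have hκ : 0 ≤ 1 - √2 / 2 := by linarith
  have h7 := mul_le_mul_of_nonneg_left
    (show (T.card : ℝ) - √2 * Fintype.card P ≤ ∑ e, l e + ∑ e, c e - √2 * Fintype.card P by
      linarith) hκ
  have h8 : (1 - √2 / 2) * ((T.card : ℝ) - √2 * Fintype.card P) =
      (1 - √2 / 2) * T.card - (√2 - √2 * √2 / 2) * Fintype.card P := by ring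
  rw [h8, h3] at h7
  linarith

/-! ### Matchings as edge sets, and augmentation -/

lemma bddAbove_matchingSizes {V : Type*} [Fintype V] (G : SimpleGraph V) :
    BddAbove {m : ℕ | ∃ N : G.Subgraph, N.IsMatching ∧ N.edgeSet.ncard = m} := by
  classical
  refine ⟨Nat.card (Sym2 V), ?_⟩
  rintro m ⟨N, -, rfl⟩
  exact Set.ncard_le_card _

lemma card_le_maxMatchingSize {V : Type*} [Fintype V] {G : SimpleGraph V} {X : Finset (Sym2 V)}
    (hX : EdgeMatching X) (hG : ∀ e ∈ X, e ∈ G.edgeSet) : X.card ≤ maxMatchingSize G := by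
  refine le_csSup (bddAbove_matchingSizes G) ?_
  let N : G.Subgraph :=
    { verts := coveredVerts X
      Adj := fun a b => s(a, b) ∈ X
      adj_sub := fun {a b} h => hG _ h
      edge_vert := fun {a b} h => ⟨s(a, b), h, by simp⟩
      symm := ⟨fun a b h => by rwa [Sym2.eq_swap]⟩ }
  refine ⟨N, ?_, ?_⟩
  · rintro v ⟨e, he, hv⟩
    obtain ⟨w, rfl⟩ := hv
    refine ⟨w, he, fun w' hw' => ?_⟩
    have := hX _ hw' _ he v (by simp) (by simp)
    exact Sym2.congr_right.mp this
  · have : N.edgeSet = (X : Set (Sym2 V)) := by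
      ext e
      induction e with
      | _ a b => rfl
    rw [this, Set.ncard_coe_finset]

/-- The edges of a matching, as a finite set. -/
lemma exists_edgeMatching_of_isMatching {V : Type*} [Fintype V] {G : SimpleGraph V}
    {N : G.Subgraph} (hN : N.IsMatching) :
    ∃ X : Finset (Sym2 V), EdgeMatching X ∧ (∀ e, e ∈ X ↔ e ∈ N.edgeSet) ∧
      X.card = N.edgeSet.ncard ∧ coveredVerts X = N.verts := by
  classical
  refine ⟨N.edgeSet.toFinite.toFinset, ?_, by simp, ?_, ?_⟩
  · intro e he e' he' v hv hv'
    rw [Set.Finite.mem_toFinset] at he he'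
    obtain ⟨w, rfl⟩ := hv
    obtain ⟨w', rfl⟩ := hv'
    rw [SimpleGraph.Subgraph.mem_edgeSet] at he he'
    rw [hN.eq_of_adj_left he he']
  · rw [Set.ncard_eq_toFinset_card _]
  · ext v
    constructor
    · rintro ⟨e, he, w, rfl⟩
      rw [Set.Finite.mem_toFinset, SimpleGraph.Subgraph.mem_edgeSet] at he
      exact N.edge_vert he
    · intro hv
      obtain ⟨w, hw, -⟩ := hN hv
      exact ⟨s(v, w), by simpa using hw, by simp⟩

lemma exists_maximum_edgeMatching {V : Type*} [Fintype V] (G : SimpleGraph V) :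
    ∃ X : Finset (Sym2 V), EdgeMatching X ∧ (∀ e ∈ X, e ∈ G.edgeSet) ∧
      X.card = maxMatchingSize G := by
  have hmem := Nat.sSup_mem (s := {m : ℕ | ∃ N : G.Subgraph, N.IsMatching ∧ N.edgeSet.ncard = m})
    ⟨0, ⊥, by simp [SimpleGraph.Subgraph.IsMatching], by simp⟩ (bddAbove_matchingSizes G)
  obtain ⟨N, hN, hcard⟩ := hmem
  obtain ⟨X, hX, hmemX, hXcard, -⟩ := exists_edgeMatching_of_isMatching hN
  exact ⟨X, hX, fun e he => N.edgeSet_subset ((hmemX e).mp he), hXcard.trans hcard⟩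

/-- The endpoint of `e` selected by `b`. -/
noncomputable def edgeEnd {V : Type*} {F : Finset (Sym2 V)} (e : F × Bool) : V :=
  if e.2 then (Quot.out e.1.1).2 else (Quot.out e.1.1).1

lemma mk_edgeEnd {V : Type*} {F : Finset (Sym2 V)} (p : F) :
    s(edgeEnd (p, false), edgeEnd (p, true)) = p.1 := by
  simp only [edgeEnd, if_true, Bool.false_eq_true, if_false]
  exact Quot.out_eq p.1

lemma mem_iff_edgeEnd {V : Type*} {F : Finset (Sym2 V)} (p : F) (v : V) :
    v ∈ p.1 ↔ ∃ b, v = edgeEnd (p, b) := by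
  rw [← mk_edgeEnd p, Sym2.mem_iff]
  simp

lemma edgeEnd_injective {V : Type*} {F : Finset (Sym2 V)} (hF : EdgeMatching F)
    (hd : ∀ e ∈ F, ¬ e.IsDiag) : Function.Injective (edgeEnd (F := F)) := by
  rintro ⟨p, b⟩ ⟨q, c⟩ h
  have hpq : p = q := Subtype.ext (hF _ p.2 _ q.2 (edgeEnd (p, b))
    ((mem_iff_edgeEnd p _).mpr ⟨b, rfl⟩) ((mem_iff_edgeEnd q _).mpr ⟨c, h⟩))
  subst hpq
  have hne : edgeEnd (p, false) ≠ edgeEnd (p, true) := by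
    have := hd _ p.2
    rwa [← mk_edgeEnd p, Sym2.mk_isDiag_iff] at this
  cases b <;> cases c
  · rfl
  · exact absurd h hne
  · exact absurd h.symm hne
  · rfl

lemma mem_coveredVerts_iff_edgeEnd {V : Type*} {F : Finset (Sym2 V)} (v : V) :
    v ∈ coveredVerts F ↔ ∃ e : F × Bool, v = edgeEnd e := by
  constructor
  · rintro ⟨e, he, hv⟩
    obtain ⟨b, hb⟩ := (mem_iff_edgeEnd ⟨e, he⟩ v).mp hv
    exact ⟨(⟨e, he⟩, b), hb⟩
  · rintro ⟨⟨p, b⟩, hv⟩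
    exact ⟨p.1, p.2, (mem_iff_edgeEnd p v).mpr ⟨b, hv⟩⟩

open Classical in
/-- Augmenting a matching `F` along disjoint paths of length three. -/
lemma card_add_card_le_maxMatchingSize {V : Type*} [Fintype V] {J : SimpleGraph V}
    {F : Finset (Sym2 V)} (hF : EdgeMatching F) (hd : ∀ e ∈ F, ¬ e.IsDiag)
    (hJ : ∀ e ∈ F, e ∈ J.edgeSet) (f : F × Bool → Option V)
    (hf1 : ∀ e e' w, f e = some w → f e' = some w → e = e')
    (hf2 : ∀ e w, f e = some w → w ∉ coveredVerts F ∧ J.Adj (edgeEnd e) w) :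
    F.card + (Finset.univ.filter fun p => (f (p, false)).isSome ∧ (f (p, true)).isSome).card ≤
      maxMatchingSize J := by
  set Succ : F → Prop := fun p => (f (p, false)).isSome ∧ (f (p, true)).isSome with hSucc
  have hsome : ∀ p, Succ p → ∀ b, (f (p, b)).isSome := by
    rintro p ⟨h0, h1⟩ (_ | _)
    · exact h0
    · exact h1
  -- An augmented pair contributes one new edge per end in place of its own edge; any other pair
  -- contributes its own edge, indexed by `false`. For augmented pairs the default of `getD` is
  -- never reached.
  set g : F × Bool → Sym2 V := fun i =>
    if Succ i.1 then s(edgeEnd i, (f i).getD (edgeEnd i)) else i.1.1 with hg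
  set I : Finset (F × Bool) := Finset.univ.filter fun i => Succ i.1 ∨ i.2 = false with hI
  have hmem : ∀ i ∈ I, ∀ v, v ∈ g i →
      (∃ b, v = edgeEnd (i.1, b) ∧ (Succ i.1 → b = i.2)) ∨ f i = some v := by
    rintro ⟨p, b⟩ - v hv
    by_cases hp : Succ p
    · obtain ⟨w, hw⟩ := Option.isSome_iff_exists.mp (hsome p hp b)
      simp only [hg, hp, if_true, hw, Option.getD_some, Sym2.mem_iff] at hv
      rcases hv with rfl | rfl
      · exact Or.inl ⟨b, rfl, fun _ => rfl⟩
      · exact Or.inr hw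
    · simp only [hg, hp, if_false] at hv
      obtain ⟨b', hb'⟩ := (mem_iff_edgeEnd p v).mp hv
      exact Or.inl ⟨b', hb', fun h => absurd h hp⟩
  have hcov : ∀ e : F × Bool, edgeEnd e ∈ coveredVerts F :=
    fun e => (mem_coveredVerts_iff_edgeEnd _).mpr ⟨e, rfl⟩
  have hdisj : ∀ i ∈ I, ∀ j ∈ I, ∀ v, v ∈ g i → v ∈ g j → i = j := by
    intro i hi j hj v hvi hvj
    rcases hmem i hi v hvi with ⟨b, hb, hb'⟩ | hv <;>
      rcases hmem j hj v hvj with ⟨c, hc, hc'⟩ | hv'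
    · have h := edgeEnd_injective hF hd (hb.symm.trans hc)
      rw [Prod.mk.injEq] at h
      obtain ⟨h1, h2⟩ := h
      refine Prod.ext h1 ?_
      rw [hI, Finset.mem_filter] at hi hj
      by_cases hS : Succ i.1
      · rw [← hb' hS, ← hc' (h1 ▸ hS), h2]
      · rw [hi.2.resolve_left hS, hj.2.resolve_left (h1 ▸ hS)]
    · exact absurd (hb ▸ hcov _) (hf2 _ _ hv').1
    · exact absurd (hc ▸ hcov _) (hf2 _ _ hv).1
    · exact hf1 _ _ _ hv hv'
  have hinj : Set.InjOn g I := by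
    intro i hi j hj h
    refine hdisj i hi j hj (g i).out.1 (Sym2.out_fst_mem _) ?_
    rw [← h]
    exact Sym2.out_fst_mem _
  have hX : EdgeMatching (I.image g) := by
    intro e he e' he' v hv hv'
    obtain ⟨i, hi, rfl⟩ := Finset.mem_image.mp he
    obtain ⟨j, hj, rfl⟩ := Finset.mem_image.mp he'
    rw [hdisj i hi j hj v hv hv']
  have hXJ : ∀ e ∈ I.image g, e ∈ J.edgeSet := by
    intro e he
    obtain ⟨⟨p, b⟩, hi, rfl⟩ := Finset.mem_image.mp he
    by_cases hp : Succ p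
    · obtain ⟨w, hw⟩ := Option.isSome_iff_exists.mp (hsome p hp b)
      simp only [hg, hp, if_true, hw, Option.getD_some]
      exact (hf2 _ _ hw).2
    · simp only [hg, hp, if_false]
      exact hJ _ p.2
  have hcard : I.card = F.card + (Finset.univ.filter Succ).card := by
    have : I = (Finset.univ ×ˢ {false}) ∪ ((Finset.univ.filter Succ) ×ˢ {true}) := by
      ext ⟨p, b⟩
      cases b <;> simp [hI]
    rw [this, Finset.card_union_of_disjoint, Finset.card_product, Finset.card_product]
    · simp
    · rw [Finset.disjoint_left]
      rintro ⟨p, b⟩ h1 h2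
      simp only [Finset.mem_product, Finset.mem_singleton] at h1 h2
      rw [h1.2] at h2
      cases h2.2
  rw [← hcard, ← Finset.card_image_of_injOn hinj]
  exact card_le_maxMatchingSize hX hXJ

/-! ### From the random b-matching to an expected matching size -/

/-- Since `(√2 - 1) * (1 + √2) = 1`, the quotient of the capacities is about `√2 - 1`. In the last
bound, which turns a nearly saturated vertex of `A` into a load of at least `√2 - 1 - θ`, the
rounding of the ceiling is absorbed by `θ * k ≥ 1`. -/
lemma nat_ceil_bounds {k : ℕ} {θ : ℝ} (hθ : 0 < θ) (hθ1 : θ ≤ 1 / 10) (hk : 1 / θ ≤ k) :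
    0 < k ∧ k ≤ ⌈(k : ℝ) * (1 + √2)⌉₊ ∧ (k : ℝ) ≤ (√2 - 1) * ⌈(k : ℝ) * (1 + √2)⌉₊ ∧
      (√2 - 1 - θ) * ⌈(k : ℝ) * (1 + √2)⌉₊ ≤ (1 - θ) * k := by
  obtain ⟨h1, h2, h3⟩ := sqrt_two_bounds
  have hkpos : (0 : ℝ) < k := lt_of_lt_of_le (by positivity) hk
  have hle := Nat.le_ceil ((k : ℝ) * (1 + √2))
  have hlt := Nat.ceil_lt_add_one (a := (k : ℝ) * (1 + √2)) (by positivity)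
  set K : ℝ := (⌈(k : ℝ) * (1 + √2)⌉₊ : ℝ) with hK
  have hkK : (k : ℝ) ≤ K := by nlinarith
  have hθk : 1 ≤ θ * k := by
    rw [div_le_iff₀ hθ] at hk
    linarith
  refine ⟨by exact_mod_cast hkpos, Nat.cast_le.mp hkK, ?_, ?_⟩
  · nlinarith
  · have e1 : (√2 - 1 - θ) * K ≤ (√2 - 1 - θ) * (k * (1 + √2) + 1) :=
      mul_le_mul_of_nonneg_left hlt.le (by linarith)
    have e2 : (√2 - 1 - θ) * (k * (1 + √2) + 1) =
        k - θ * k - θ * k * √2 + (√2 - 1 - θ) + (√2 * √2 - 2) * k := by ring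
    have e3 : √2 - 1 - θ ≤ θ * k * √2 := by nlinarith
    rw [h3] at e2
    linarith

lemma capacity_of_mem_left {V : Type*} {A W : Set V} {k K : ℕ} {v : V} (h : v ∈ A) :
    capacity A W k K v = k := if_pos h

lemma capacity_of_mem_right {V : Type*} {A W : Set V} (hAW : Disjoint A W) {k K : ℕ} {v : V}
    (h : v ∈ W) : capacity A W k K v = K := by
  unfold capacity
  rw [if_neg (fun h' => Set.disjoint_left.mp hAW h' h), if_pos h]

lemma capacity_le {V : Type*} {A W : Set V} {k K : ℕ} (hkK : k ≤ K) (v : V) :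
    capacity A W k K v ≤ K := by
  unfold capacity
  split_ifs
  · exact hkK
  · exact le_rfl
  · exact Nat.zero_le _

lemma adj_of_mem_projectEdges {V : Type*} {H : SimpleGraph V} {c : V → ℕ}
    (π : EdgeOrder (copiesGraph H c)) {u w : V}
    (h : s(u, w) ∈ projectEdges (greedyMatching _ π)) : H.Adj u w := by
  obtain ⟨e, he, hm⟩ := Multiset.mem_map.mp h
  have he' := greedyMatching_subset _ π he
  induction e with
  | _ x y =>
    have hadj : H.Adj x.1 y.1 := he'
    rw [← SimpleGraph.mem_edgeSet] at hadj ⊢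
    rwa [← hm]

open Classical in
/-- If the `b`-matching treats all edges in `N` well, then it yields many augmentations of `F`. -/
lemma le_maxMatchingSize_of_outcome {V : Type*} [Fintype V] {θ : ℝ} (hθ : 0 < θ)
    (hθ1 : θ ≤ 1 / 10) {k K : ℕ} (hk0 : 0 < k) (hkK : k ≤ K)
    (hkβ : (k : ℝ) ≤ (√2 - 1) * K) (hKk : (√2 - 1 - θ) * K ≤ (1 - θ) * k)
    {H : SimpleGraph V} {A W : Set V} (hAW : Disjoint A W)
    (hH : ∀ u w, H.Adj u w → u ∈ A ∧ w ∈ W ∨ u ∈ W ∧ w ∈ A) {F : Finset (Sym2 V)} (hF : EdgeMatching F) (hd : ∀ e ∈ F, ¬ e.IsDiag)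
    (hFA : coveredVerts F = A)
    (π : EdgeOrder (copiesGraph H (capacity A W k K)))
    (N : Finset (V × V)) (hN : ∀ p ∈ N, p.1 ∈ A ∧ p.2 ∈ W)
    (hN1 : ∀ p ∈ N, ∀ q ∈ N, p.1 = q.1 → p = q) (hN2 : ∀ p ∈ N, ∀ q ∈ N, p.2 = q.2 → p = q)
    (hgood : ∀ p ∈ N, s(p.1, p.2) ∈ projectEdges (greedyMatching _ π) ∨
      (1 - θ) * k ≤ cappedDegree (θ ^ 6 * k) (greedyMatching _ π) p.1 ∨
      (1 - θ) * K ≤ cappedDegree (θ ^ 6 * k) (greedyMatching _ π) p.2) :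
    (2 - √2) * F.card + (1 - √2 / 2) * N.card - 12 * θ * F.card ≤
      maxMatchingSize (SimpleGraph.fromEdgeSet
        {e | e ∈ F ∨ e ∈ projectEdges (greedyMatching _ π)}) := by
  have hK0 : (0 : ℝ) < K := by exact_mod_cast hk0.trans_le hkK
  set B := greedyMatching (copiesGraph H (capacity A W k K)) π with hB
  have hBdeg : ∀ v, ∑ w, (edgeCount B v w : ℝ) ≤ capacity A W k K v := by
    intro v
    have := freeCopies_add_sum_edgeCount (edgeMatching_greedyMatching _ π)
      (fun e he => greedyMatching_subset _ π he) v
    exact_mod_cast (Nat.le_add_left _ _).trans this.le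
  have hHadj : ∀ {u w}, u ∈ A → H.Adj u w → w ∈ W := by
    intro u w hu h
    rcases hH _ _ h with h' | h'
    · exact h'.2
    · exact absurd h'.1 (Set.disjoint_left.mp hAW hu)
  have hHadj' : ∀ {u w}, w ∈ W → H.Adj u w → u ∈ A := by
    intro u w hw h
    rcases hH _ _ h with h' | h'
    · exact h'.1
    · exact absurd hw (Set.disjoint_left.mp hAW h'.2)
  have hendA : ∀ e : F × Bool, edgeEnd e ∈ A := fun e => by
    rw [← hFA]
    exact (mem_coveredVerts_iff_edgeEnd _).mpr ⟨e, rfl⟩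
  have hinj := edgeEnd_injective hF hd
  -- The cap makes every entry at most `θ ^ 6`, because `k ≤ K`.
  set x : F × Bool → V → ℝ := fun e w => min (edgeCount B (edgeEnd e) w : ℝ) (θ ^ 6 * k) / K
    with hx
  have hD0 : 0 ≤ θ ^ 6 * (k : ℝ) := by positivity
  have hx0 : ∀ e w, 0 ≤ x e w := fun e w =>
    div_nonneg (le_min (Nat.cast_nonneg _) hD0) hK0.le
  have hsumx : ∀ e, ∑ w, x e w = cappedDegree (θ ^ 6 * k) B (edgeEnd e) / K := by
    intro e
    rw [hx, ← Finset.sum_div]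
    rfl
  have hcap : ∀ v, cappedDegree (θ ^ 6 * k) B v ≤ capacity A W k K v := fun v =>
    (Finset.sum_le_sum fun w _ => min_le_left _ _).trans (hBdeg v)
  have hsumx' : ∀ w, ∑ e, x e w ≤ cappedDegree (θ ^ 6 * k) B w / K := by
    intro w
    simp only [hx]
    rw [← Finset.sum_div]
    refine div_le_div_of_nonneg_right ?_ hK0.le
    unfold cappedDegree
    simp only [fun e : F × Bool => edgeCount_comm B (edgeEnd e) w]
    rw [← Finset.sum_image (f := fun v => min (edgeCount B w v : ℝ) (θ ^ 6 * k))
      (g := edgeEnd) fun a _ b _ h => hinj h]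
    exact Finset.sum_le_sum_of_subset_of_nonneg (Finset.subset_univ _)
      fun v _ _ => le_min (Nat.cast_nonneg _) hD0
  -- All neighbours of `w ∈ W` in `H` are ends of `F`, so restricting the sum to ends loses nothing.
  have hsumxW : ∀ w ∈ W, ∑ e, x e w = cappedDegree (θ ^ 6 * k) B w / K := by
    intro w hw
    simp only [hx]
    rw [← Finset.sum_div]
    congr 1
    unfold cappedDegree
    refine Fintype.sum_of_injective edgeEnd hinj _ _ ?_ ?_
    · intro v hv
      have h0 : edgeCount B w v = 0 := by
        by_contra hne
        apply hv
        have hadj := adj_of_mem_projectEdges π ((edgeCount_ne_zero_iff B w v).mp hne)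
        have hvA := hHadj' hw hadj.symm
        rw [← hFA, mem_coveredVerts_iff_edgeEnd] at hvA
        obtain ⟨e, he⟩ := hvA
        exact ⟨e, he.symm⟩
      simp [h0, hD0]
    · intro e
      rw [edgeCount_comm]
  set T : Finset (F × Bool) := Finset.univ.filter fun e => ∃ a, (edgeEnd e, a) ∈ N with hT
  set mate : F × Bool → V := fun e => if h : ∃ a, (edgeEnd e, a) ∈ N then h.choose else edgeEnd e
    with hmate
  have hmateN : ∀ e ∈ T, (edgeEnd e, mate e) ∈ N := by
    intro e he
    have h := (Finset.mem_filter.mp he).2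
    simp only [hmate, dif_pos h]
    exact h.choose_spec
  have hTcard : N.card ≤ T.card := by
    have hsurj : ∀ p ∈ N, ∃ e : F × Bool, p.1 = edgeEnd e := by
      intro p hp
      rw [← mem_coveredVerts_iff_edgeEnd, hFA]
      exact (hN p hp).1
    have hsub : N ⊆ T.image fun e => (edgeEnd e, mate e) := by
      intro p hp
      obtain ⟨e, he⟩ := hsurj p hp
      have heT : e ∈ T := Finset.mem_filter.mpr ⟨Finset.mem_univ _, p.2, by rw [← he]; exact hp⟩
      exact Finset.mem_image.mpr ⟨e, heT, hN1 _ (hmateN e heT) _ hp he.symm⟩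
    exact (Finset.card_le_card hsub).trans Finset.card_image_le
  obtain ⟨f, hf1, hf2, hf3⟩ := exists_augmentation hθ hθ1 x hx0
    (fun e w => by
      rw [hx]
      dsimp only
      rw [div_le_iff₀ hK0]
      refine (min_le_right _ _).trans ?_
      have : (k : ℝ) ≤ K := by exact_mod_cast hkK
      gcongr)
    (fun e w => H.Adj (edgeEnd e) w ∧ s(edgeEnd e, w) ∈ projectEdges B)
    (fun e w hne => by
      have hne' : edgeCount B (edgeEnd e) w ≠ 0 := by
        intro h0
        apply hne
        simp [hx, h0, hD0]
      have hm := (edgeCount_ne_zero_iff B _ _).mp hne'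
      exact ⟨adj_of_mem_projectEdges π hm, hm⟩)
    (fun e => by
      rw [hsumx, div_le_iff₀ hK0]
      refine (hcap _).trans ?_
      rw [capacity_of_mem_left (hendA e)]
      exact hkβ)
    (fun w => by
      refine (hsumx' w).trans ?_
      rw [div_le_one hK0]
      refine (hcap w).trans ?_
      exact_mod_cast capacity_le hkK w)
    T mate
    (fun e he e' he' h => by
      have := hN2 _ (hmateN e he) _ (hmateN e' he') h
      exact hinj (Prod.mk.inj this).1)
    (fun e he => by
      have hp := hmateN e he
      rw [hsumx, hsumxW _ (hN _ hp).2, le_div_iff₀ hK0, le_div_iff₀ hK0]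
      rcases hgood _ hp with h | h | h
      · exact Or.inl ⟨adj_of_mem_projectEdges π h, h⟩
      · exact Or.inr (Or.inl (hKk.trans h))
      · exact Or.inr (Or.inr h))
  have haug := card_add_card_le_maxMatchingSize (J := SimpleGraph.fromEdgeSet
      {e | e ∈ F ∨ e ∈ projectEdges B}) hF hd
    (fun e he => by
      rw [SimpleGraph.edgeSet_fromEdgeSet]
      exact ⟨Or.inl he, hd e he⟩) f hf1
    (fun e w h => by
      obtain ⟨ha, hb⟩ := hf2 e w h
      have hw := hHadj (hendA e) ha
      refine ⟨fun hc => ?_, ?_⟩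
      · rw [hFA] at hc
        exact Set.disjoint_left.mp hAW hc hw
      · rw [SimpleGraph.fromEdgeSet_adj]
        exact ⟨Or.inr hb, ha.ne⟩)
  have haug' : (F.card : ℝ) +
      ((Finset.univ.filter fun p => (f (p, false)).isSome ∧ (f (p, true)).isSome).card : ℝ) ≤
      maxMatchingSize (SimpleGraph.fromEdgeSet {e | e ∈ F ∨ e ∈ projectEdges B}) := by
    exact_mod_cast haug
  have hTc : (N.card : ℝ) ≤ T.card := by exact_mod_cast hTcard
  have hκ : 0 ≤ 1 - √2 / 2 := by linarith [sqrt_two_bounds.2.1]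
  have := mul_le_mul_of_nonneg_left hTc hκ
  rw [Fintype.card_coe] at hf3
  linarith

lemma nonempty_edgeOrder {V : Type*} [Finite V] (H : SimpleGraph V) : Nonempty (EdgeOrder H) :=
  ⟨(Finite.equivFin H.edgeSet).symm⟩

lemma expectRGMM_eq_sum_div {V : Type*} [Fintype V] (H : SimpleGraph V) [Fintype (EdgeOrder H)]
    (f : Finset (Sym2 V) → ℝ) :
    expectRGMM H f = (∑ π : EdgeOrder H, f (greedyMatching H π)) / Fintype.card (EdgeOrder H) := by
  have h : ∀ (i j : Fintype (EdgeOrder H)),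
      (@Finset.univ _ i).expect (fun π => f (greedyMatching H π)) =
        (∑ π ∈ @Finset.univ _ j, f (greedyMatching H π)) / @Fintype.card _ j := by
    intro i j
    rw [Subsingleton.elim i j, Fintype.expect_eq_sum_div_card]
  exact h _ _

lemma le_expectRGMM {V : Type*} [Fintype V] (H : SimpleGraph V) (f : Finset (Sym2 V) → ℝ) (c : ℝ)
    (h : ∀ π : EdgeOrder H, c ≤ f (greedyMatching H π)) : c ≤ expectRGMM H f := by
  obtain ⟨_⟩ := nonempty_fintype (EdgeOrder H)
  have := nonempty_edgeOrder H
  rw [expectRGMM_eq_sum_div, le_div_iff₀ (by exact_mod_cast Fintype.card_pos)]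
  refine le_trans (le_of_eq ?_) (Finset.sum_le_sum fun π _ => h π)
  rw [Finset.sum_const, nsmul_eq_mul, Finset.card_univ, mul_comm]

/-- Exponential growth beats linear growth. The bound `4 * k + 2` leaves room for both capacities
plus one. -/
lemma exists_forall_pow_lt {θ : ℝ} (hθ : 0 < θ) :
    ∃ k₀ : ℕ, ∀ k : ℕ, k₀ ≤ k → 1 / θ ≤ k ∧
      ∀ n : ℕ, (1 + θ) ^ n < 4 * (k : ℝ) + 2 → (n : ℝ) ≤ θ ^ 6 * k := by
  have ht := tendsto_pow_const_div_const_pow_of_one_lt 1 (show 1 < 1 + θ by linarith)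
  have hpos : 0 < θ ^ 6 / 6 := by positivity
  obtain ⟨N, hN⟩ := Filter.eventually_atTop.mp (ht.eventually (gt_mem_nhds hpos))
  refine ⟨⌈max (1 / θ) (N / θ ^ 6)⌉₊ + 1, fun k hk => ?_⟩
  have h1 : max (1 / θ) (N / θ ^ 6) ≤ k := by
    refine (Nat.le_ceil _).trans ?_
    exact_mod_cast (Nat.le_succ _).trans hk
  have hk1 : (1 : ℝ) ≤ k := by exact_mod_cast (Nat.le_add_left 1 _).trans hk
  refine ⟨(le_max_left _ _).trans h1, fun n hn => ?_⟩
  by_contra! hcon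
  have h2 : (N : ℝ) ≤ θ ^ 6 * k := by
    have := (le_max_right _ _).trans h1
    rw [div_le_iff₀ (by positivity)] at this
    linarith
  have hNn : N ≤ n := by exact_mod_cast (h2.trans hcon.le)
  have h3 := hN n hNn
  rw [pow_one, div_lt_iff₀ (by positivity)] at h3
  have h4 : θ ^ 6 * k < θ ^ 6 / 6 * (1 + θ) ^ n := hcon.trans h3
  have h5 : θ ^ 6 / 6 * (1 + θ) ^ n ≤ θ ^ 6 / 6 * (6 * k) := by
    gcongr
    linarith
  linarith

lemma card_le_two_mul_of_fst_mem {V : Type*} {F : Finset (Sym2 V)}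
    {N : Finset (V × V)} (hN : ∀ p ∈ N, p.1 ∈ coveredVerts F)
    (hN1 : ∀ p ∈ N, ∀ q ∈ N, p.1 = q.1 → p = q) : N.card ≤ 2 * F.card := by
  classical
  rw [← Finset.card_image_of_injOn (f := Prod.fst) (s := N) fun p hp q hq => hN1 p hp q hq]
  have hsub : N.image Prod.fst ⊆ (Finset.univ : Finset (F × Bool)).image edgeEnd := by
    intro v hv
    obtain ⟨p, hp, rfl⟩ := Finset.mem_image.mp hv
    obtain ⟨e, he⟩ := (mem_coveredVerts_iff_edgeEnd _).mp (hN p hp)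
    exact Finset.mem_image.mpr ⟨e, Finset.mem_univ _, he.symm⟩
  refine (Finset.card_le_card hsub).trans (Finset.card_image_le.trans ?_)
  simp [mul_comm]

/-- A matching `F` and the random greedy `b`-matching between its vertices and `W` contain a
large matching in expectation. -/
theorem le_expectRGBMatching {V : Type*} [Fintype V] {θ : ℝ} (hθ : 0 < θ) (hθ1 : θ ≤ 1 / 10)
    {k : ℕ} (hk : 1 / θ ≤ k)
    (hpow : ∀ n : ℕ, (1 + θ) ^ n < 4 * (k : ℝ) + 2 → (n : ℝ) ≤ θ ^ 6 * k)
    (G : SimpleGraph V) (A W : Set V) (hAW : Disjoint A W) {F : Finset (Sym2 V)}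
    (hF : EdgeMatching F) (hd : ∀ e ∈ F, ¬ e.IsDiag) (hFA : coveredVerts F = A)
    (N : Finset (V × V)) (hN : ∀ p ∈ N, p.1 ∈ A ∧ p.2 ∈ W ∧ G.Adj p.1 p.2)
    (hN1 : ∀ p ∈ N, ∀ q ∈ N, p.1 = q.1 → p = q) (hN2 : ∀ p ∈ N, ∀ q ∈ N, p.2 = q.2 → p = q) :
    (2 - √2) * F.card + (1 - √2 / 2) * N.card - 14 * θ * F.card ≤
      expectRGBMatching G A W k ⌈(k : ℝ) * (1 + √2)⌉₊ fun B =>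
        (maxMatchingSize (SimpleGraph.fromEdgeSet {e | e ∈ F ∨ e ∈ B}) : ℝ) := by
  classical
  obtain ⟨h1, h2, h3⟩ := sqrt_two_bounds
  obtain ⟨hk0, hkK, hkβ, hKk⟩ := nat_ceil_bounds hθ hθ1 hk
  have hk0' : (1 : ℝ) ≤ k := by exact_mod_cast hk0
  have hK4 : (⌈(k : ℝ) * (1 + √2)⌉₊ : ℝ) + 1 ≤ 4 * k + 2 := by
    have := Nat.ceil_lt_add_one (a := (k : ℝ) * (1 + √2)) (by positivity)
    nlinarith
  unfold expectRGBMatching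
  generalize ⌈(k : ℝ) * (1 + √2)⌉₊ = K at *
  have hkK' : (k : ℝ) ≤ K := by exact_mod_cast hkK
  have hH : ∀ u w, (G.between A W).Adj u w → u ∈ A ∧ w ∈ W ∨ u ∈ W ∧ w ∈ A :=
    fun u w h => (SimpleGraph.between_adj.mp h).2
  set H := G.between A W with hHdef
  have := nonempty_edgeOrder (copiesGraph H (capacity A W k K))
  obtain ⟨_⟩ := nonempty_fintype (EdgeOrder (copiesGraph H (capacity A W k K)))
  rw [expectRGMM_eq_sum_div, le_div_iff₀ (by exact_mod_cast Fintype.card_pos)]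
  set good : EdgeOrder (copiesGraph H (capacity A W k K)) → V × V → Prop := fun π p =>
    s(p.1, p.2) ∈ projectEdges (greedyMatching _ π) ∨
      (1 - θ) * k ≤ cappedDegree (θ ^ 6 * k) (greedyMatching _ π) p.1 ∨
      (1 - θ) * K ≤ cappedDegree (θ ^ 6 * k) (greedyMatching _ π) p.2 with hgood
  have hout : ∀ π : EdgeOrder (copiesGraph H (capacity A W k K)),
      (2 - √2) * F.card + (1 - √2 / 2) * (N.filter (good π)).card - 12 * θ * F.card ≤
      maxMatchingSize (SimpleGraph.fromEdgeSet
        {e | e ∈ F ∨ e ∈ projectEdges (greedyMatching _ π)}) := by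
    intro π
    refine le_maxMatchingSize_of_outcome hθ hθ1 hk0 hkK hkβ hKk hAW hH hF hd hFA π
      (N.filter (good π)) ?_ ?_ ?_ ?_
    · exact fun p hp => ⟨(hN p (Finset.mem_filter.mp hp).1).1, (hN p (Finset.mem_filter.mp hp).1).2.1⟩
    · exact fun p hp q hq => hN1 p (Finset.mem_filter.mp hp).1 q (Finset.mem_filter.mp hq).1
    · exact fun p hp q hq => hN2 p (Finset.mem_filter.mp hp).1 q (Finset.mem_filter.mp hq).1
    · exact fun p hp => (Finset.mem_filter.mp hp).2
  refine le_trans ?_ (Finset.sum_le_sum fun π _ => hout π)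
  have hbad : ∀ p ∈ N, ((Finset.univ.filter fun π => ¬ good π p).card : ℝ) ≤
      2 * θ * Fintype.card (EdgeOrder (copiesGraph H (capacity A W k K))) := by
    rintro ⟨u, a⟩ hp
    obtain ⟨hu, ha, hadj⟩ := hN _ hp
    have hHua : H.Adj u a := SimpleGraph.between_adj.mpr ⟨hadj, Or.inl ⟨hu, ha⟩⟩
    have hcu : capacity A W k K u = k := capacity_of_mem_left hu
    have hca : capacity A W k K a = K := capacity_of_mem_right hAW ha
    have := card_not_good_le (H := H) (c := capacity A W k K) (D := θ ^ 6 * k) hθ hHua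
      (fun w hw => by
        rw [hca]
        rcases hH _ _ hw with h | h
        · exact capacity_of_mem_right hAW h.2
        · exact absurd h.1 (Set.disjoint_left.mp hAW hu))
      (fun w hw => by
        rw [hcu]
        rcases hH _ _ hw with h | h
        · exact absurd ha (Set.disjoint_left.mp hAW h.1)
        · exact capacity_of_mem_left h.2)
      (by rw [hcu]; exact hk0) (by rw [hca]; exact hk0.trans_le hkK)
      (fun n hn => hpow n (by rw [hcu] at hn; linarith))
      (fun n hn => hpow n (by rw [hca] at hn; linarith))
    rwa [hcu, hca] at this
  have hcount : ∀ π, ((N.filter (good π)).card : ℝ) = N.card - (N.filter fun p => ¬ good π p).card := by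
    intro π
    have := Finset.card_filter_add_card_filter_not (s := N) (good π)
    have : ((N.filter (good π)).card : ℝ) + (N.filter fun p => ¬ good π p).card = N.card := by
      exact_mod_cast this
    linarith
  have hswap : ∑ π : EdgeOrder (copiesGraph H (capacity A W k K)),
      ((N.filter fun p => ¬ good π p).card : ℝ) =
      ∑ p ∈ N, ((Finset.univ.filter fun π => ¬ good π p).card : ℝ) := by
    simp only [Finset.card_filter, Nat.cast_sum]
    rw [Finset.sum_comm]
  have hbadsum := Finset.sum_le_sum hbad
  rw [← hswap, Finset.sum_const, nsmul_eq_mul] at hbadsum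
  set C : ℝ := (Fintype.card (EdgeOrder (copiesGraph H (capacity A W k K))) : ℝ) with hC
  have hC0 : 0 ≤ C := Nat.cast_nonneg _
  have hNF : (N.card : ℝ) ≤ 2 * F.card := by
    exact_mod_cast card_le_two_mul_of_fst_mem (fun p hp => hFA ▸ (hN p hp).1) hN1
  simp only [hcount]
  simp only [mul_sub, Finset.sum_sub_distrib, Finset.sum_add_distrib, Finset.sum_const,
    nsmul_eq_mul, Finset.card_univ, ← hC, ← Finset.mul_sum]
  have e1 : (1 - √2 / 2) * ∑ π : EdgeOrder (copiesGraph H (capacity A W k K)),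
      ((N.filter fun p => ¬ good π p).card : ℝ) ≤ (1 - √2 / 2) * (N.card * (2 * θ * C)) :=
    mul_le_mul_of_nonneg_left hbadsum (by linarith)
  -- Each pair of `N` is bad with probability at most `2 * θ`, and `N.card ≤ 2 * F.card`; this
  -- raises the error from `12 * θ` to `14 * θ` per edge of `F`.
  have e2 : (1 - √2 / 2) * (N.card * (2 * θ * C)) ≤ (1 / 2) * (2 * F.card * (2 * θ * C)) := by
    gcongr
    linarith
  linarith

/-! ### Counting how a matching meets V(F) -/

section Counting
variable {V : Type*} [Fintype V]

open Classical in
/-- The ordered pairs from `A` to `W` that form an edge of `X`. -/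
noncomputable def crossPairs (X : Finset (Sym2 V)) (A W : Set V) : Finset (V × V) :=
  Finset.univ.filter fun p => s(p.1, p.2) ∈ X ∧ p.1 ∈ A ∧ p.2 ∈ W

lemma mem_crossPairs {X : Finset (Sym2 V)} {A W : Set V} {p : V × V} :
    p ∈ crossPairs X A W ↔ s(p.1, p.2) ∈ X ∧ p.1 ∈ A ∧ p.2 ∈ W := by
  simp [crossPairs]

lemma crossPairs_fst_injective {X : Finset (Sym2 V)} (hX : EdgeMatching X) {A W : Set V} :
    ∀ p ∈ crossPairs X A W, ∀ q ∈ crossPairs X A W, p.1 = q.1 → p = q := by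
  intro p hp q hq h
  have := hX _ (mem_crossPairs.mp hp).1 _ (mem_crossPairs.mp hq).1 p.1 (by simp) (by simp [h])
  rw [h, Sym2.congr_right] at this
  exact Prod.ext h this

lemma crossPairs_snd_injective {X : Finset (Sym2 V)} (hX : EdgeMatching X) {A W : Set V} :
    ∀ p ∈ crossPairs X A W, ∀ q ∈ crossPairs X A W, p.2 = q.2 → p = q := by
  intro p hp q hq h
  have := hX _ (mem_crossPairs.mp hp).1 _ (mem_crossPairs.mp hq).1 p.2 (by simp) (by simp [h])
  rw [h, Sym2.congr_left] at this
  exact Prod.ext this h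

open Classical in
lemma card_filter_coveredVerts_le (F : Finset (Sym2 V)) :
    (Finset.univ.filter fun v => v ∈ coveredVerts F).card ≤ 2 * F.card := by
  have hsub : (Finset.univ.filter fun v => v ∈ coveredVerts F) ⊆
      (Finset.univ : Finset (F × Bool)).image edgeEnd := by
    intro v hv
    obtain ⟨e, he⟩ := (mem_coveredVerts_iff_edgeEnd _).mp (Finset.mem_filter.mp hv).2
    exact Finset.mem_image.mpr ⟨e, Finset.mem_univ _, he.symm⟩
  refine (Finset.card_le_card hsub).trans (Finset.card_image_le.trans ?_)
  simp [mul_comm]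

open Classical in
lemma sum_card_covered_le {X : Finset (Sym2 V)} (hX : EdgeMatching X) (F : Finset (Sym2 V)) :
    ∑ e ∈ X, (Finset.univ.filter fun v => v ∈ coveredVerts F ∧ v ∈ e).card ≤ 2 * F.card := by
  refine le_trans ?_ (card_filter_coveredVerts_le F)
  rw [← Finset.card_biUnion]
  · refine Finset.card_le_card fun v hv => ?_
    obtain ⟨e, _, hv⟩ := Finset.mem_biUnion.mp hv
    exact Finset.mem_filter.mpr ⟨Finset.mem_univ _, (Finset.mem_filter.mp hv).2.1⟩
  · intro e he e' he' hne
    rw [Function.onFun, Finset.disjoint_left]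
    intro v hv hv'
    exact hne (hX e he e' he' v (Finset.mem_filter.mp hv).2.2 (Finset.mem_filter.mp hv').2.2)

open Classical in
lemma card_le_two_mul_add {X : Finset (Sym2 V)} (hX : EdgeMatching X) (F : Finset (Sym2 V)) :
    X.card ≤ 2 * F.card + (X.filter fun e => ∀ v ∈ e, v ∉ coveredVerts F).card := by
  have h : ∀ e ∈ X, 1 ≤ (Finset.univ.filter fun v => v ∈ coveredVerts F ∧ v ∈ e).card +
      if ∀ v ∈ e, v ∉ coveredVerts F then 1 else 0 := by
    intro e _
    split_ifs with h
    · exact Nat.le_add_left _ _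
    · push Not at h
      obtain ⟨v, hv, hc⟩ := h
      exact Finset.card_pos.mpr ⟨v, Finset.mem_filter.mpr ⟨Finset.mem_univ _, hc, hv⟩⟩
  have h2 := Finset.sum_le_sum h
  rw [Finset.sum_add_distrib, ← Finset.card_filter] at h2
  simp only [Finset.sum_const, smul_eq_mul, mul_one] at h2
  have := sum_card_covered_le hX F
  omega

open Classical in
/-- A matching `X` with few edges avoiding `V(F)` has many edges with exactly one end in
`V(F)`. -/
lemma two_mul_card_le {X : Finset (Sym2 V)} (hX : EdgeMatching X) (hd : ∀ e ∈ X, ¬ e.IsDiag)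
    (F : Finset (Sym2 V)) (W : Set V) (hW : ∀ e ∈ X, ∀ v ∈ e, v ∈ coveredVerts F ∨ v ∈ W) :
    2 * X.card ≤ (crossPairs X (coveredVerts F) W).card + 2 * F.card +
      2 * (X.filter fun e => ∀ v ∈ e, v ∉ coveredVerts F).card := by
  -- An edge collects 2 from two covered ends, from one covered end and one crossing pair, or from
  -- the last term if no end is covered.
  have h : ∀ e ∈ X, 2 ≤ ((crossPairs X (coveredVerts F) W).filter fun p => s(p.1, p.2) = e).card +
      (Finset.univ.filter fun v => v ∈ coveredVerts F ∧ v ∈ e).card +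
      2 * if ∀ v ∈ e, v ∉ coveredVerts F then 1 else 0 := by
    intro e he
    have hde := hd e he
    have hWe := hW e he
    induction e with
    | _ a b =>
      rw [Sym2.mk_isDiag_iff] at hde
      have ha := hWe a (by simp)
      have hb := hWe b (by simp)
      by_cases hca : a ∈ coveredVerts F <;> by_cases hcb : b ∈ coveredVerts F
      · have : ({a, b} : Finset V) ⊆
            Finset.univ.filter fun v => v ∈ coveredVerts F ∧ v ∈ s(a, b) := by
          intro v hv
          simp only [Finset.mem_insert, Finset.mem_singleton] at hv
          rcases hv with rfl | rfl <;> simp [hca, hcb]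
        have := Finset.card_le_card this
        rw [Finset.card_pair hde] at this
        omega
      · have h1 : 0 < ((crossPairs X (coveredVerts F) W).filter
            fun p => s(p.1, p.2) = s(a, b)).card :=
          Finset.card_pos.mpr ⟨(a, b), Finset.mem_filter.mpr
            ⟨mem_crossPairs.mpr ⟨he, hca, hb.resolve_left hcb⟩, rfl⟩⟩
        have h2 : 0 < (Finset.univ.filter fun v => v ∈ coveredVerts F ∧ v ∈ s(a, b)).card :=
          Finset.card_pos.mpr ⟨a, by simp [hca]⟩
        omega
      · have h1 : 0 < ((crossPairs X (coveredVerts F) W).filter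
            fun p => s(p.1, p.2) = s(a, b)).card :=
          Finset.card_pos.mpr ⟨(b, a), Finset.mem_filter.mpr
            ⟨mem_crossPairs.mpr ⟨by rwa [Sym2.eq_swap], hcb, ha.resolve_left hca⟩, Sym2.eq_swap⟩⟩
        have h2 : 0 < (Finset.univ.filter fun v => v ∈ coveredVerts F ∧ v ∈ s(a, b)).card :=
          Finset.card_pos.mpr ⟨b, by simp [hcb]⟩
        omega
      · rw [if_pos]
        · omega
        · intro v hv
          rcases Sym2.mem_iff.mp hv with rfl | rfl <;> assumption
  have h2 := Finset.sum_le_sum h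
  rw [Finset.sum_add_distrib, Finset.sum_add_distrib, ← Finset.mul_sum, ← Finset.card_filter,
    ← Finset.card_eq_sum_card_fiberwise (f := fun p : V × V => s(p.1, p.2)) (t := X)
      (fun p hp => (mem_crossPairs.mp hp).1)] at h2
  simp only [Finset.sum_const, smul_eq_mul] at h2
  have := sum_card_covered_le hX F
  omega

end Counting

/-! ### The two options and their trade-off -/

lemma EdgeMatching.not_isDiag_of_subset {V : Type*} {G : SimpleGraph V} {X : Finset (Sym2 V)}
    (h : ∀ e ∈ X, e ∈ G.edgeSet) : ∀ e ∈ X, ¬ e.IsDiag :=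
  fun e he => G.not_isDiag_of_mem_edgeSet (h e he)

open Classical in
/-- Lower bound for the augmentation of `M`. -/
lemma le_expectSecond {V : Type*} [Fintype V] {θ : ℝ} (hθ : 0 < θ) (hθ1 : θ ≤ 1 / 10)
    {k : ℕ} (hk : 1 / θ ≤ k)
    (hpow : ∀ n : ℕ, (1 + θ) ^ n < 4 * (k : ℝ) + 2 → (n : ℝ) ≤ θ ^ 6 * k)
    {G : SimpleGraph V} {M : G.Subgraph} {F X : Finset (Sym2 V)} (hF : EdgeMatching F)
    (hFM : ∀ e, e ∈ F ↔ e ∈ M.edgeSet) (hFv : coveredVerts F = M.verts)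
    (hX : EdgeMatching X) (hXG : ∀ e ∈ X, e ∈ G.edgeSet) :
    (2 - √2) * (X.card - (X.filter fun e => ∀ v ∈ e, v ∉ coveredVerts F).card) -
      14 * θ * F.card ≤ expectSecond G M k ⌈(k : ℝ) * (1 + √2)⌉₊ := by
  have hFd : ∀ e ∈ F, ¬ e.IsDiag := EdgeMatching.not_isDiag_of_subset (G := G)
    fun e he => M.edgeSet_subset ((hFM e).mp he)
  have h := le_expectRGBMatching hθ hθ1 hk hpow G M.verts M.vertsᶜ disjoint_compl_right hF hFd hFv
    (crossPairs X (coveredVerts F) (coveredVerts F)ᶜ)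
    (fun p hp => by
      obtain ⟨h1, h2, h3⟩ := mem_crossPairs.mp hp
      rw [← hFv]
      exact ⟨h2, h3, hXG _ h1⟩)
    (crossPairs_fst_injective hX) (crossPairs_snd_injective hX)
  have hcount := two_mul_card_le hX (EdgeMatching.not_isDiag_of_subset hXG) F (coveredVerts F)ᶜ
    (fun e _ v _ => Classical.em _)
  have hcount' : 2 * (X.card : ℝ) ≤ (crossPairs X (coveredVerts F) (coveredVerts F)ᶜ).card +
      2 * F.card + 2 * (X.filter fun e => ∀ v ∈ e, v ∉ coveredVerts F).card := by
    exact_mod_cast hcount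
  have hκ : 0 ≤ 1 - √2 / 2 := by linarith [sqrt_two_bounds.2.1]
  -- As `2 - √2 = 2 * (1 - √2 / 2)`, the main terms in `F.card` cancel.
  have h2 := mul_le_mul_of_nonneg_left hcount' hκ
  unfold expectSecond
  simp only [hFM] at h
  linarith

open Classical in
/-- Lower bound for the matching found outside of `V(M)`. -/
lemma le_expectFirst {V : Type*} [Fintype V] {θ : ℝ} (hθ : 0 < θ) (hθ1 : θ ≤ 1 / 10)
    {k : ℕ} (hk : 1 / θ ≤ k)
    (hpow : ∀ n : ℕ, (1 + θ) ^ n < 4 * (k : ℝ) + 2 → (n : ℝ) ≤ θ ^ 6 * k)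
    {G : SimpleGraph V} {M : G.Subgraph} {X : Finset (Sym2 V)}
    (hX : EdgeMatching X) (hXG : ∀ e ∈ X, e ∈ G.edgeSet) (hXM : ∀ e ∈ X, ∀ v ∈ e, v ∉ M.verts) :
    (2 - √2) * X.card - 14 * θ * maxMatchingSize G ≤
      expectFirst G M k ⌈(k : ℝ) * (1 + √2)⌉₊ := by
  unfold expectFirst
  have hadj : ∀ u v, (G.induce M.vertsᶜ).spanningCoe.Adj u v ↔
      u ∉ M.verts ∧ v ∉ M.verts ∧ G.Adj u v := by
    intro u v
    simp only [SimpleGraph.map_adj, SimpleGraph.comap_adj, Function.Embedding.subtype_apply]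
    constructor
    · rintro ⟨a, b, h, rfl, rfl⟩
      exact ⟨a.2, b.2, h⟩
    · rintro ⟨hu, hv, h⟩
      exact ⟨⟨u, hu⟩, ⟨v, hv⟩, h, rfl, rfl⟩
  set H := (G.induce M.vertsᶜ).spanningCoe with hH
  refine le_expectRGMM _ _ _ fun π => ?_
  set F := greedyMatching H π with hFdef
  have hF : EdgeMatching F := edgeMatching_greedyMatching H π
  have hFH : ∀ e ∈ F, e ∈ H.edgeSet := fun e he => greedyMatching_subset H π he
  have hFG : ∀ e ∈ F, e ∈ G.edgeSet := by
    intro e he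
    have := hFH e he
    induction e with
    | _ a b => exact ((hadj a b).mp this).2.2
  -- Every edge of `X` lies outside V(M), so the maximal matching `F` there meets all of them.
  have hmax : (X.filter fun e => ∀ v ∈ e, v ∉ coveredVerts F) = ∅ := by
    rw [Finset.filter_eq_empty_iff]
    intro e he hfree
    have heH : e ∈ H.edgeSet := by
      have h1 := hXM e he
      have h2 := hXG e he
      induction e with
      | _ a b => exact (hadj a b).mpr ⟨h1 a (by simp), h1 b (by simp), h2⟩
    obtain ⟨v, hv, hc⟩ := greedyMatching_maximal H π heH
    exact hfree v hv hc
  have h := le_expectRGBMatching hθ hθ1 hk hpow G (coveredVerts F) (M.vertsᶜ \ coveredVerts F)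
    Set.disjoint_sdiff_right hF (EdgeMatching.not_isDiag_of_subset hFG) rfl
    (crossPairs X (coveredVerts F) (M.vertsᶜ \ coveredVerts F))
    (fun p hp => by
      obtain ⟨h1, h2, h3⟩ := mem_crossPairs.mp hp
      exact ⟨h2, h3, hXG _ h1⟩)
    (crossPairs_fst_injective hX) (crossPairs_snd_injective hX)
  have hcount := two_mul_card_le hX (EdgeMatching.not_isDiag_of_subset hXG) F
    (M.vertsᶜ \ coveredVerts F) (fun e he v hv => by
      by_cases hc : v ∈ coveredVerts F
      · exact Or.inl hc
      · exact Or.inr ⟨hXM e he v hv, hc⟩)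
  rw [hmax, Finset.card_empty, mul_zero, add_zero] at hcount
  have hcount' : 2 * (X.card : ℝ) ≤
      (crossPairs X (coveredVerts F) (M.vertsᶜ \ coveredVerts F)).card + 2 * F.card := by
    exact_mod_cast hcount
  have hκ : 0 ≤ 1 - √2 / 2 := by linarith [sqrt_two_bounds.2.1]
  have h2 := mul_le_mul_of_nonneg_left hcount' hκ
  have hm : (F.card : ℝ) ≤ maxMatchingSize G := by
    exact_mod_cast card_le_maxMatchingSize hF hFG
  have h3 := mul_le_mul_of_nonneg_left hm (show 0 ≤ 14 * θ by positivity)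
  refine le_trans ?_ h
  linarith

/-- The numerical trade-off between the two options. -/
lemma tradeoff {ε θ μ m n E₁ E₂ : ℝ} (hε : 0 < ε) (hε1 : ε ≤ 1 / 10 ^ 6) (hθ : θ = 1 / 10 ^ 6)
    (hμ : 0 ≤ μ) (hn : 0 ≤ n) (hm : m ≤ μ) (hμm : μ ≤ 2 * m + n)
    (h₁ : (2 - √2) * n - 14 * θ * μ ≤ E₁) (h₂ : (2 - √2) * (μ - n) - 14 * θ * m ≤ E₂) :
    0.5109 * μ ≤ (1 - ε) * max (m + E₁) E₂ := by
  obtain ⟨s1, s2, -⟩ := sqrt_two_bounds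
  have hs1 : (1.41421 : ℝ) < √2 := Real.lt_sqrt_of_sq_lt (by norm_num)
  have hs2 : √2 < 1.41422 := by
    rw [Real.sqrt_lt' (by norm_num)]
    norm_num
  subst hθ
  have hmax1 := le_max_left (m + E₁) E₂
  have hmax2 := le_max_right (m + E₁) E₂
  set Z := max (m + E₁) E₂
  -- From `m ≥ (μ - n) / 2`; `0.08578` is just below `3 / 2 - √2`, and `0.000014` is `14 * θ`.
  have a1 : 0.5 * μ + 0.08578 * n - 0.000014 * μ ≤ Z := by nlinarith
  have a2 : (2 - √2) * μ - 0.58579 * n - 0.000014 * μ ≤ Z := by nlinarith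
  have a3 : 0.58578 * μ ≤ (2 - √2) * μ := by nlinarith
  -- Eliminating `n` between `a1` and `a2` gives about `0.51094`; the surplus over `0.5109` pays for
  -- the factor `1 - ε`.
  have hZ : 0.51092 * μ ≤ Z := by linarith
  have hZ0 : 0 ≤ Z := le_trans (by positivity) hZ
  nlinarith

end SublinearMatching

theorem mainTheorem6 :
    ∃ ε₀ : ℝ, 0 < ε₀ ∧
      ∀ ε : ℝ, 0 < ε → ε < ε₀ →
      ∀ k : ℕ, 1 / ((1 + √2) * ε ^ 3) < (k : ℝ) →
      ∀ (V : Type*) [Fintype V] (G : SimpleGraph V) (M : G.Subgraph), M.IsMatching →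
        0.5109 * (SublinearMatching.maxMatchingSize G : ℝ) ≤
          (1 - ε) *
            max ((M.edgeSet.ncard : ℝ) +
                SublinearMatching.expectFirst G M k ⌈(k : ℝ) * (1 + √2)⌉₊)
              (SublinearMatching.expectSecond G M k ⌈(k : ℝ) * (1 + √2)⌉₊) := by
  classical
  obtain ⟨k₀, hk₀⟩ := SublinearMatching.exists_forall_pow_lt
    (show (0 : ℝ) < 1 / 10 ^ 6 by norm_num)
  -- The second term makes `(1 + √2) * ε ^ 3 ≤ 3 * ε ≤ 1 / (k₀ + 1)`, so the hypothesis on `k`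
  -- forces `k₀ ≤ k`.
  refine ⟨min (1 / 10 ^ 6) (1 / (3 * (k₀ + 1))), by positivity, ?_⟩
  intro ε hε hε₀ k hk V _ G M hM
  have hε1 : ε < 1 / 10 ^ 6 := hε₀.trans_le (min_le_left _ _)
  have hε2 : ε < 1 / (3 * (k₀ + 1)) := hε₀.trans_le (min_le_right _ _)
  obtain ⟨-, s2, -⟩ := SublinearMatching.sqrt_two_bounds
  have hkk : k₀ ≤ k := by
    have h1 : (1 + √2) * ε ^ 3 ≤ 3 * ε := by
      have : ε ^ 3 ≤ ε := by
        calc ε ^ 3 ≤ ε ^ 1 := pow_le_pow_of_le_one hε.le (by linarith) (by norm_num)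
          _ = ε := pow_one ε
      have : (1 + √2) * ε ^ 3 ≤ 3 * ε ^ 3 := by
        have : 0 ≤ ε ^ 3 := by positivity
        nlinarith
      linarith
    have h2 : (k₀ : ℝ) + 1 ≤ 1 / ((1 + √2) * ε ^ 3) := by
      rw [le_div_iff₀ (by positivity)]
      rw [lt_div_iff₀ (by positivity)] at hε2
      calc ((k₀ : ℝ) + 1) * ((1 + √2) * ε ^ 3) ≤ (k₀ + 1) * (3 * ε) := by gcongr
        _ ≤ 1 := by linarith
    have h3 : (k₀ : ℝ) ≤ k := by linarith
    exact_mod_cast h3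
  obtain ⟨hk1, hk2⟩ := hk₀ k hkk
  obtain ⟨F, hF, hFM, hFcard, hFv⟩ := SublinearMatching.exists_edgeMatching_of_isMatching hM
  obtain ⟨X, hX, hXG, hXcard⟩ := SublinearMatching.exists_maximum_edgeMatching G
  have hFG : ∀ e ∈ F, e ∈ G.edgeSet := fun e he => M.edgeSet_subset ((hFM e).mp he)
  have h₂ := SublinearMatching.le_expectSecond (by norm_num) (by norm_num) hk1 hk2 hF hFM hFv hX hXG
  set X₀ := X.filter fun e => ∀ v ∈ e, v ∉ SublinearMatching.coveredVerts F with hX₀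
  have h₁ := SublinearMatching.le_expectFirst (M := M) (by norm_num) (by norm_num) hk1 hk2
    (hX.mono (Finset.filter_subset _ _)) (fun e he => hXG e (Finset.mem_filter.mp he).1)
    (X := X₀) (fun e he v hv => hFv ▸ (Finset.mem_filter.mp he).2 v hv)
  have hcount := SublinearMatching.card_le_two_mul_add hX F
  have hm := SublinearMatching.card_le_maxMatchingSize hF hFG
  rw [hXcard] at h₂ hcount
  rw [← hFcard]
  refine SublinearMatching.tradeoff hε hε1.le rfl (Nat.cast_nonneg _) (Nat.cast_nonneg X₀.card)
    (by exact_mod_cast hm) (by exact_mod_cast hcount) h₁ h₂
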